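/- Theorem 4.1. Let $A$ be a complex Banach algebra, not necessarily unital. For $n\ge 0$ let $C^n(A)$ be the Banach space of bounded $(n+1)$-linear functionals $f:A^{n+1}\to\mathbb C$, and let $\delta^n:C^n(A)\to C^{n+1}(A)$ be $$(\delta^n f)(a_0,\dots,a_{n+1})=\sum_{i=0}^{n}(-1)^i f(a_0,\dots,a_ia_{i+1},\dots,a_{n+1})+(-1)^{n+1}f(a_{n+1}a_0,a_1,\dots,a_n).$$ Let $CC^n(A)\subseteq C^n(A)$ be the subspace of cyclic cochains, i.e. those $f$ with $f(a_0,\dots,a_n)=(-1)^n f(a_1,\dots,a_n,a_0)$ for all $a_0,\dots,a_n\in A$. For a closed subalgebra $B$ of $A$ let $CC^n_B(A)$ be the subspace of those $f\in CC^n(A)$ that are $B$-relative, i.e. such that for all $s\in B$ and $a_0,\dots,a_n\in A$ $$f(sa_0,a_1,\dots,a_n)=f(a_0,\dots,a_{n-1},a_ns),\qquad f(a_0,\dots,a_js,a_{j+1},\dots,a_n)=f(a_0,\dots,a_j,sa_{j+1},\dots,a_n)\quad(0\le j\le n-1).$$ Both families are subcomplexes for $\delta$. Their $n$-th cohomology groups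 (cocycles modulo coboundaries, with the quotient seminorm) are the Banach cyclic cohomology group $\mathcal{HC}^n(A)$ and the Banach $B$-relative cyclic cohomology group $\mathcal{HC}^n_B(A)$. Suppose that $A$ has a (two-sided) bounded approximate identity and that $B$ is an amenable closed subalgebra of $A$, that is, for every Banach $B$-bimodule $X$ every bounded derivation from $B$ into the dual bimodule $X^*$ is inner. Then, for every $n\ge 0$, the map $\mathcal{HC}^n_B(A)\to\mathcal{HC}^n(A)$ induced by the inclusion $CC^n_B(A)\subseteq CC^n(A)$ is a linear isomorphism and a homeomorphism; in particular $\mathcal{HC}^n(A)\cong\mathcal{HC}^n_B(A)$ as seminormed spaces (topological isomorphism). -/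

import Mathlib

set_option maxSynthPendingDepth 3

universe u

noncomputable section

/-- A subalgebra of a normed algebra is a normed space with the restricted norm. -/
instance NonUnitalSubalgebra.instNormedSpaceComplex {A : Type u} [NonUnitalNormedRing A]
    [NormedSpace ℂ A] (B : NonUnitalSubalgebra ℂ A) : NormedSpace ℂ B where
  norm_smul_le c x := norm_smul_le c (x : A)

/-! ### Bounded approximate identities -/

/-- `A` has a (two-sided) bounded approximate identity: a filter `l` on `A` (equivalently, a net)
along which `e * a → a` and `a * e → a` for every `a`, and which is bounded in norm. -/
def HasBoundedApproximateIdentity (A : Type u) [NonUnitalNormedRing A] : Prop :=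
  ∃ l : Filter A, l.IsApproximateUnit ∧ ∃ K : ℝ, ∀ᶠ e in l, ‖e‖ ≤ K

/-! ### Banach bimodules and amenability -/

/-- The structure of a (bounded) bimodule over the Banach algebra `A` on the normed space `X`:
`lsmul a x` is `a · x` and `rsmul a x` is `x · a`. -/
structure BanachBimodule (A X : Type u)
    [NonUnitalNormedRing A] [NormedSpace ℂ A] [NormedAddCommGroup X] [NormedSpace ℂ X] where
  /-- the left action `a · x` -/
  lsmul : A →L[ℂ] X →L[ℂ] X
  /-- the right action `x · a` -/
  rsmul : A →L[ℂ] X →L[ℂ] X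
  mul_lsmul : ∀ a b x, lsmul (a * b) x = lsmul a (lsmul b x)
  rsmul_mul : ∀ a b x, rsmul (a * b) x = rsmul b (rsmul a x)
  lsmul_rsmul : ∀ a b x, lsmul a (rsmul b x) = rsmul b (lsmul a x)

/-- The Banach algebra `A` is amenable: `H¹(A, X*) = 0` for every dual Banach `A`-bimodule `X*`.
Here `X*` carries the dual actions `⟨x, a · φ⟩ = ⟨x · a, φ⟩` and `⟨x, φ · a⟩ = ⟨a · x, φ⟩`. A
1-cocycle is a bounded linear `D : A → X*` with `D (a b) = a · D b + D a · b`, and a 1-coboundary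
is a map `a ↦ a · φ - φ · a` with `φ` in `X*`. -/
def IsAmenableBanachAlgebra (A : Type u) [NonUnitalNormedRing A] [NormedSpace ℂ A] : Prop :=
  ∀ (X : Type u) [NormedAddCommGroup X] [NormedSpace ℂ X] [CompleteSpace X]
    (m : BanachBimodule A X) (D : A →L[ℂ] StrongDual ℂ X),
    (∀ a b x, D (a * b) x = D b (m.rsmul a x) + D a (m.lsmul b x)) →
      ∃ φ : StrongDual ℂ X, ∀ a x, D a x = φ (m.rsmul a x) - φ (m.lsmul a x)

/-! ### The cyclic complexes -/

namespace BanachCyclic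

variable (A : Type u) [NonUnitalNormedRing A] [NormedSpace ℂ A]

/-- `C^n(A)`: the Banach space (with the operator norm) of bounded `(n+1)`-linear functionals
`f (a₀, …, aₙ)` on `A`. -/
abbrev Cochain (n : ℕ) : Type u :=
  ContinuousMultilinearMap ℂ (fun _ : Fin (n + 1) => A) ℂ

variable {A}

/-- The signed cyclic shift `(t f)(a₀, …, aₙ) = (-1)^n f(a₁, …, aₙ, a₀)`. -/
def cyclicShift (n : ℕ) (f : Cochain A n) : Cochain A n :=
  (-1 : ℂ) ^ n • f.domDomCongr (finRotate (n + 1))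

variable (A) in
/-- The cyclic cochains: those `f` in `C^n(A)` with `t f = f`. -/
def cyclicCochains (n : ℕ) : Submodule ℂ (Cochain A n) where
  carrier := {f | cyclicShift n f = f}
  zero_mem' := by ext v; simp [cyclicShift]
  add_mem' {f g} hf hg := by
    ext v
    have h1 := congrArg (fun h : Cochain A n => h v) hf
    have h2 := congrArg (fun h : Cochain A n => h v) hg
    simp only [cyclicShift, _root_.smul_apply,
      ContinuousMultilinearMap.domDomCongr_apply, smul_eq_mul,
      _root_.add_apply] at h1 h2 ⊢
    rw [mul_add, h1, h2]
  smul_mem' c f hf := by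
    ext v
    have h1 := congrArg (fun h : Cochain A n => h v) hf
    simp only [cyclicShift, _root_.smul_apply,
      ContinuousMultilinearMap.domDomCongr_apply, smul_eq_mul] at h1 ⊢
    rw [mul_left_comm, h1]

/-- The `B`-relative cochains: those `f` in `C^n(A)` with
`f(s a₀, a₁, …, aₙ) = f(a₀, …, aₙ s)` and
`f(a₀, …, aⱼ s, aⱼ₊₁, …, aₙ) = f(a₀, …, aⱼ, s aⱼ₊₁, …, aₙ)` for `0 ≤ j ≤ n - 1`, for all `s` in `B`
and `a₀, …, aₙ` in `A`. -/
def relativeCochains (B : NonUnitalSubalgebra ℂ A) (n : ℕ) : Submodule ℂ (Cochain A n) where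
  carrier := {f | ∀ s ∈ B, ∀ a : Fin (n + 1) → A,
    f (Function.update a 0 (s * a 0)) =
        f (Function.update a (Fin.last n) (a (Fin.last n) * s)) ∧
      ∀ j : Fin n, f (Function.update a j.castSucc (a j.castSucc * s)) =
        f (Function.update a j.succ (s * a j.succ))}
  zero_mem' := by intro s _ a; simp
  add_mem' {f g} hf hg := by
    intro s hs a
    refine ⟨?_, fun j => ?_⟩
    · simp only [_root_.add_apply, (hf s hs a).1, (hg s hs a).1]
    · simp only [_root_.add_apply, (hf s hs a).2 j, (hg s hs a).2 j]
  smul_mem' c f hf := by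
    intro s hs a
    refine ⟨?_, fun j => ?_⟩
    · simp only [_root_.smul_apply, (hf s hs a).1]
    · simp only [_root_.smul_apply, (hf s hs a).2 j]

section Coboundary

variable [IsScalarTower ℂ A A] [SMulCommClass ℂ A A]

theorem contractNth_update {n : ℕ} (i : Fin (n + 1)) (v : Fin (n + 2) → A) (k : Fin (n + 2)) :
    ∃ (p : Fin (n + 1)) (L : A →ₗ[ℂ] A), ∀ x : A,
      i.castSucc.contractNth (· * ·) (Function.update v k x) =
        Function.update (i.castSucc.contractNth (· * ·) v) p (L x) := by
  rcases lt_trichotomy (k : ℕ) (i : ℕ) with h | h | h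
  · refine ⟨⟨k, by omega⟩, LinearMap.id, fun x => ?_⟩
    funext q
    simp only [Fin.contractNth, Function.update_apply, Fin.ext_iff, Fin.val_castSucc,
      Fin.val_succ, LinearMap.id_apply]
    grind
  · refine ⟨i, LinearMap.mulRight ℂ (v i.succ), fun x => ?_⟩
    funext q
    simp only [Fin.contractNth, Function.update_apply, Fin.ext_iff, Fin.val_castSucc,
      Fin.val_succ, LinearMap.mulRight_apply]
    grind
  · rcases (show (i : ℕ) + 1 ≤ k by omega).eq_or_lt with h' | h'
    · refine ⟨i, LinearMap.mulLeft ℂ (v i.castSucc), fun x => ?_⟩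
      funext q
      simp only [Fin.contractNth, Function.update_apply, Fin.ext_iff, Fin.val_castSucc,
        Fin.val_succ, LinearMap.mulLeft_apply]
      grind
    · refine ⟨⟨k - 1, by omega⟩, LinearMap.id, fun x => ?_⟩
      funext q
      simp only [Fin.contractNth, Function.update_apply, Fin.ext_iff, Fin.val_castSucc,
        Fin.val_succ, LinearMap.id_apply]
      grind

/-- `(face i f)(a₀, …, aₙ₊₁) = f(a₀, …, aᵢ aᵢ₊₁, …, aₙ₊₁)` for `0 ≤ i ≤ n`. -/
def face {n : ℕ} (i : Fin (n + 1)) (f : Cochain A n) : Cochain A (n + 1) where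
  toFun v := f (i.castSucc.contractNth (· * ·) v)
  map_update_add' {inst} v k x y := by
    rw [Subsingleton.elim inst (instDecidableEqFin _)]
    obtain ⟨p, L, h⟩ := contractNth_update i v k
    simp only [h, map_add, f.map_update_add]
  map_update_smul' {inst} v k c x := by
    rw [Subsingleton.elim inst (instDecidableEqFin _)]
    obtain ⟨p, L, h⟩ := contractNth_update i v k
    simp only [h, map_smul, f.map_update_smul]
  cont := by
    refine f.cont.comp (continuous_pi fun q => ?_)
    unfold Fin.contractNth
    split_ifs <;> fun_prop

/-- `(lastFace f)(a₀, …, aₙ₊₁) = f(aₙ₊₁ a₀, a₁, …, aₙ)`. -/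
def lastFace {n : ℕ} (f : Cochain A n) : Cochain A (n + 1) :=
  (face 0 f).domDomCongr (finRotate (n + 2)).symm

theorem face_add {n : ℕ} (i : Fin (n + 1)) (f g : Cochain A n) :
    face i (f + g) = face i f + face i g := rfl

theorem face_smul {n : ℕ} (i : Fin (n + 1)) (c : ℂ) (f : Cochain A n) :
    face i (c • f) = c • face i f := rfl

theorem lastFace_add {n : ℕ} (f g : Cochain A n) :
    lastFace (f + g) = lastFace f + lastFace g := rfl

theorem lastFace_smul {n : ℕ} (c : ℂ) (f : Cochain A n) :
    lastFace (c • f) = c • lastFace f := rfl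

variable (A) in
/-- The coboundary operator `δ^n : C^n(A) → C^{n+1}(A)`,
`(δ^n f)(a₀, …, aₙ₊₁) = ∑_{i=0}^n (-1)^i f(a₀, …, aᵢ aᵢ₊₁, …, aₙ₊₁)`
`+ (-1)^{n+1} f(aₙ₊₁ a₀, a₁, …, aₙ)`. -/
def coboundary (n : ℕ) : Cochain A n →ₗ[ℂ] Cochain A (n + 1) where
  toFun f := ∑ i : Fin (n + 1), (-1 : ℂ) ^ (i : ℕ) • face i f + (-1 : ℂ) ^ (n + 1) • lastFace f
  map_add' f g := by
    simp only [face_add, lastFace_add, smul_add, Finset.sum_add_distrib]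
    abel
  map_smul' c f := by
    simp only [face_smul, lastFace_smul, smul_add, Finset.smul_sum, RingHom.id_apply,
      smul_comm c]

/-! ### Cohomology of a family of subspaces of the cochain spaces

For a family `K n ⊆ C^n(A)` that is stable under the coboundary operators, these are the cocycles,
the coboundaries and the cohomology of the subcomplex formed by the `K n`. -/

/-- The `n`-cocycles: the kernel of `δ^n` in `K n`. -/
def cocycles (K : ∀ n, Submodule ℂ (Cochain A n)) (n : ℕ) : Submodule ℂ (Cochain A n) :=
  K n ⊓ LinearMap.ker (coboundary A n)

/-- The `n`-coboundaries: the image of `K (n - 1)` under `δ^{n-1}`, and `0` for `n = 0`. -/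
def coboundaries (K : ∀ n, Submodule ℂ (Cochain A n)) : ∀ n, Submodule ℂ (Cochain A n)
  | 0 => ⊥
  | n + 1 => (K n).map (coboundary A n)

/-- The `n`-th cohomology group, cocycles modulo coboundaries, with the quotient seminorm of the
operator norm. -/
abbrev Cohomology (K : ∀ n, Submodule ℂ (Cochain A n)) (n : ℕ) : Type u :=
  cocycles K n ⧸ (coboundaries K n).submoduleOf (cocycles K n)

/-- The `B`-relative cyclic cochains. -/
def relativeCyclicCochains (B : NonUnitalSubalgebra ℂ A) (n : ℕ) : Submodule ℂ (Cochain A n) :=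
  cyclicCochains A n ⊓ relativeCochains B n

theorem relativeCocycles_le (B : NonUnitalSubalgebra ℂ A) (n : ℕ) :
    cocycles (relativeCyclicCochains B) n ≤ cocycles (cyclicCochains A) n :=
  inf_le_inf_right _ inf_le_left

variable (A) in
/-- The Banach cyclic cohomology group `HC^n(A)`. -/
abbrev HC (n : ℕ) : Type u := Cohomology (cyclicCochains A) n

/-- The Banach `B`-relative cyclic cohomology group `HC^n_B(A)`. -/
abbrev HCrel (B : NonUnitalSubalgebra ℂ A) (n : ℕ) : Type u :=
  Cohomology (relativeCyclicCochains B) n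

end Coboundary

end BanachCyclic

end

/-! The comparison map is inverted by averaging over approximate diagonals of `B`. Amenability gives
finite sums M = 1 ⊗ 1 + M' with M' = ∑ (x_k ⊗ y_k - x_k y_k ⊗ 1) over the unitization of `B`, which
multiply to 1, are uniformly bounded and commute with `B` asymptotically
(`exists_approximate_diagonal`). Inserting M at every cyclic junction of the arguments of f gives
`average 1 f`. Since M multiplies to 1 and all junctions are treated alike, averaging preserves
cyclic cochains and commutes on them with δ. It fixes `B`-relative cochains
(`average_of_mem_relativeCochains`), and its pointwise limits along the approximate diagonals are
`B`-relative (`norm_average_commutator_le`).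

The main point is that averaging is homotopic to the identity on cyclic cocycles, within the cyclic
complex. On the segment 1 ⊗ 1 + z M' every element still multiplies to 1, while the direction M'
multiplies to 0. For cyclic f the z-derivative of the average is N Q_z, where N is the sum of the
powers of the signed shift and Q_z carries M' at the last junction only (`cyclicNorm_averageDeriv`).
Insert an element e behind the last argument, with M' before it and 1 ⊗ 1 after it. If δf = 0, the
bar differential b' of the result (all signed faces but the cyclic one) is, up to sign, Q_z with its
first argument multiplied by e (`insertion_coboundary`). Integrate over z in [0, 1], let e run
through the bounded approximate identity and apply N: the relation N b' = δ N
(`cyclicNorm_sum_signedFace`) gives a cyclic h with δh = average 1 f - f and ‖h‖ ≤ C ‖f‖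
(`exists_coboundary_eq_average_sub`).

The bounds do not depend on the diagonal, so a weak limit shows that each cyclic cocycle of positive
degree is cohomologous to a relative one of comparable norm. This gives surjectivity and the
continuity of the inverse. For injectivity, averaging g when δg is relative gives in the limit a
relative cochain with the same coboundary. In degree 0 a cocycle is a trace and already relative. -/

noncomputable section

namespace BanachCyclic

/-! ### Approximate diagonals of an amenable algebra -/

section ApproximateDiagonal

variable {B : Type u} [NonUnitalNormedRing B]

theorem norm_zero_prod_mk (y : B) : ‖((0 : ℂ), y)‖ = ‖y‖ := by simp [Prod.norm_def]

variable [NormedSpace ℂ B]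

variable (B) in
/-- The bounded bilinear forms `ψ (x, y)` with `x` in the unitization of `B` and `y` in `B`. -/
abbrev UnitizationForm : Type u := (ℂ × B) →L[ℂ] B →L[ℂ] ℂ

theorem UnitizationForm.map_inr_add (ψ : UnitizationForm B) (a b : B) :
    ψ (0, a + b) = ψ (0, a) + ψ (0, b) := by
  rw [← map_add]; simp

theorem UnitizationForm.map_inr_smul (ψ : UnitizationForm B) (c : ℂ) (a : B) :
    ψ (0, c • a) = c • ψ (0, a) := by
  rw [← map_smul]; simp

theorem UnitizationForm.norm_apply_le (ψ : UnitizationForm B) (x : ℂ × B) (y : B) :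
    ‖ψ x y‖ ≤ ‖ψ‖ * ‖x‖ * ‖y‖ := ψ.le_opNorm₂ x y

theorem norm_smul_add_mul_le (x : ℂ × B) (y : B) : ‖x.1 • y + x.2 * y‖ ≤ 2 * ‖x‖ * ‖y‖ := by
  have h1 : ‖x.1 • y‖ ≤ ‖x‖ * ‖y‖ := by
    rw [norm_smul]; gcongr; exact norm_fst_le x
  have h2 : ‖x.2 * y‖ ≤ ‖x‖ * ‖y‖ :=
    (norm_mul_le _ _).trans (by gcongr; exact norm_snd_le x)
  linarith [norm_add_le (x.1 • y) (x.2 * y)]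

theorem norm_smul_add_mul_le' (x : ℂ × B) (y : B) : ‖x.1 • y + y * x.2‖ ≤ 2 * ‖x‖ * ‖y‖ := by
  have h1 : ‖x.1 • y‖ ≤ ‖x‖ * ‖y‖ := by
    rw [norm_smul]; gcongr; exact norm_fst_le x
  have h2 : ‖y * x.2‖ ≤ ‖x‖ * ‖y‖ :=
    (norm_mul_le _ _).trans (by rw [mul_comm]; gcongr; exact norm_snd_le x)
  linarith [norm_add_le (x.1 • y) (y * x.2)]

variable (B) in
/-- Evaluation of a form, as a functional on forms. -/
def evalForm : (ℂ × B) →L[ℂ] B →L[ℂ] StrongDual ℂ (UnitizationForm B) :=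
  (ContinuousLinearMap.flipₗᵢ ℂ (UnitizationForm B) B ℂ).toContinuousLinearEquiv.toContinuousLinearMap.comp
    (ContinuousLinearMap.id ℂ (UnitizationForm B)).flip

@[simp]
theorem evalForm_apply (x : ℂ × B) (y : B) (ψ : UnitizationForm B) : evalForm B x y ψ = ψ x y := rfl

/-- The bound on real parts controls absolute values because x may be multiplied by a scalar that
turns χ x y onto the positive axis and brings ‖x‖ ‖y‖ up to K. -/
theorem UnitizationForm.norm_le_of_re_lt {χ : UnitizationForm B} {K u : ℝ} (hK : 0 < K)
    (h : ∀ x y, ‖x‖ * ‖y‖ ≤ K → (χ x y).re < u) : ‖χ‖ ≤ u / K := by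
  have hu0 : 0 < u := by simpa using h 0 0 (by simp [hK.le])
  refine ContinuousLinearMap.opNorm_le_bound₂ _ (by positivity) fun x y => ?_
  rw [div_mul_eq_mul_div, div_mul_eq_mul_div, le_div_iff₀ (by positivity), mul_comm]
  by_cases h0 : χ x y = 0
  · rw [h0, norm_zero, mul_zero]; positivity
  have hx : 0 < ‖x‖ := norm_pos_iff.2 fun h => h0 (by simp [h])
  have hy : 0 < ‖y‖ := norm_pos_iff.2 fun h => h0 (by simp [h])
  have hz : 0 < ‖χ x y‖ := norm_pos_iff.2 h0
  set c : ℂ := (K / (‖x‖ * ‖y‖ * ‖χ x y‖) : ℝ) * (starRingEnd ℂ) (χ x y) with hc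
  have hcn : ‖c‖ = K / (‖x‖ * ‖y‖) := by
    rw [hc, norm_mul, Complex.norm_real, RCLike.norm_conj, Real.norm_of_nonneg (by positivity)]
    field_simp
  have h1 := h (c • x) y (by rw [norm_smul, hcn]; field_simp; rfl)
  have h2 : χ (c • x) y = (K * ‖χ x y‖ / (‖x‖ * ‖y‖) : ℝ) := by
    rw [map_smul, smul_apply, smul_eq_mul, hc, mul_assoc, ← Complex.normSq_eq_conj_mul_self,
      Complex.normSq_eq_norm_sq, ← Complex.ofReal_mul]
    congr 1
    field_simp
  rw [h2, Complex.ofReal_re, div_lt_iff₀ (by positivity)] at h1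
  linarith

/-- Composition of a functional on the dual of the space of forms with evaluations. -/
def formOfBidual (lam : StrongDual ℂ (StrongDual ℂ (UnitizationForm B))) : UnitizationForm B :=
  (ContinuousLinearMap.compL ℂ B (StrongDual ℂ (UnitizationForm B)) ℂ lam).comp (evalForm B)

theorem formOfBidual_apply (lam : StrongDual ℂ (StrongDual ℂ (UnitizationForm B))) (x : ℂ × B)
    (y : B) : formOfBidual lam x y = lam (evalForm B x y) := rfl

variable [IsScalarTower ℂ B B] [SMulCommClass ℂ B B]

variable (B)

/-- The product of an element of the unitization `ℂ × B` with an element of the ideal `B`. -/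
def unitizationMul : (ℂ × B) →L[ℂ] B →L[ℂ] B :=
  (ContinuousLinearMap.lsmul ℂ ℂ).comp (ContinuousLinearMap.fst ℂ ℂ B) +
    (ContinuousLinearMap.mul ℂ B).comp (ContinuousLinearMap.snd ℂ ℂ B)

/-- The product of an element of the ideal `B` with an element of the unitization `ℂ × B`. -/
def mulUnitization : B →L[ℂ] (ℂ × B) →L[ℂ] B :=
  (ContinuousLinearMap.smulRightL ℂ (ℂ × B) B (ContinuousLinearMap.fst ℂ ℂ B)) +
    ((ContinuousLinearMap.compL ℂ (ℂ × B) B B).flip (ContinuousLinearMap.snd ℂ ℂ B)).comp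
      (ContinuousLinearMap.mul ℂ B)

variable {B}

@[simp]
theorem unitizationMul_apply (x : ℂ × B) (y : B) :
    unitizationMul B x y = x.1 • y + x.2 * y := rfl

@[simp]
theorem mulUnitization_apply (b : B) (x : ℂ × B) :
    mulUnitization B b x = x.1 • b + b * x.2 := rfl

/-- The form `ψ(b x, y)`. -/
def UnitizationForm.rightAct (b : B) (ψ : UnitizationForm B) : UnitizationForm B :=
  ψ.comp ((ContinuousLinearMap.inr ℂ ℂ B).comp (mulUnitization B b))

/-- The form `ψ(x, y b) - ψ(x y, b)`. -/
def UnitizationForm.leftAct (b : B) (ψ : UnitizationForm B) : UnitizationForm B :=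
  (ContinuousLinearMap.compL ℂ B B ℂ).flip ((ContinuousLinearMap.mul ℂ B).flip b) ∘L ψ -
    (ContinuousLinearMap.compL ℂ B B ℂ
      ((ψ.flip b).comp (ContinuousLinearMap.inr ℂ ℂ B))).comp (unitizationMul B)

theorem UnitizationForm.rightAct_apply (b : B) (ψ : UnitizationForm B) (x : ℂ × B) (y : B) :
    rightAct b ψ x y = ψ (0, x.1 • b + b * x.2) y := rfl

theorem UnitizationForm.leftAct_apply (b : B) (ψ : UnitizationForm B) (x : ℂ × B) (y : B) :
    leftAct b ψ x y = ψ x (y * b) - ψ (0, x.1 • y + x.2 * y) b := rfl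

theorem UnitizationForm.mul_leftAct (a b : B) (ψ : UnitizationForm B) :
    leftAct (a * b) ψ = leftAct a (leftAct b ψ) := by
  ext x y <;> simp [leftAct_apply, mul_assoc]

theorem UnitizationForm.mul_rightAct (a b : B) (ψ : UnitizationForm B) :
    rightAct (a * b) ψ = rightAct b (rightAct a ψ) := by
  ext x y <;> simp [rightAct_apply, mul_assoc]

theorem UnitizationForm.leftAct_rightAct (a b : B) (ψ : UnitizationForm B) :
    leftAct a (rightAct b ψ) = rightAct b (leftAct a ψ) := by
  ext x y <;> simp [leftAct_apply, rightAct_apply, mul_assoc]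

theorem UnitizationForm.norm_rightAct_le (b : B) (ψ : UnitizationForm B) :
    ‖rightAct b ψ‖ ≤ 2 * ‖b‖ * ‖ψ‖ := by
  refine ContinuousLinearMap.opNorm_le_bound₂ _ (by positivity) fun x y => ?_
  rw [rightAct_apply]
  refine (ψ.norm_apply_le _ _).trans ?_
  rw [norm_zero_prod_mk]
  calc ‖ψ‖ * ‖x.1 • b + b * x.2‖ * ‖y‖ ≤ ‖ψ‖ * (2 * ‖x‖ * ‖b‖) * ‖y‖ := by
        gcongr; exact norm_smul_add_mul_le' x b
    _ = _ := by ring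

theorem UnitizationForm.norm_leftAct_le (b : B) (ψ : UnitizationForm B) :
    ‖leftAct b ψ‖ ≤ 3 * ‖b‖ * ‖ψ‖ := by
  refine ContinuousLinearMap.opNorm_le_bound₂ _ (by positivity) fun x y => ?_
  rw [leftAct_apply]
  have h1 : ‖ψ x (y * b)‖ ≤ ‖ψ‖ * ‖x‖ * (‖y‖ * ‖b‖) :=
    (ψ.norm_apply_le _ _).trans (by gcongr; exact norm_mul_le _ _)
  have h2 : ‖ψ (0, x.1 • y + x.2 * y) b‖ ≤ ‖ψ‖ * (2 * ‖x‖ * ‖y‖) * ‖b‖ := by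
    refine (ψ.norm_apply_le _ _).trans ?_
    rw [norm_zero_prod_mk]
    gcongr; exact norm_smul_add_mul_le x y
  calc _ ≤ ‖ψ x (y * b)‖ + ‖ψ (0, x.1 • y + x.2 * y) b‖ := norm_sub_le _ _
    _ ≤ _ := by linarith

variable (B) in
/-- The `B`-bimodule of bounded bilinear forms on the unitization of `B` modulo those that factor
through the multiplication. -/
def unitizationFormBimodule : BanachBimodule B (UnitizationForm B) where
  lsmul := LinearMap.mkContinuous₂ (LinearMap.mk₂ ℂ UnitizationForm.leftAct
    (fun a b ψ => by
      ext x y <;> simp [UnitizationForm.leftAct_apply, mul_add] <;> ring)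
    (fun c b ψ => by
      ext x y <;> simp [UnitizationForm.leftAct_apply, mul_smul_comm] <;> ring)
    (fun b ψ χ => by
      ext x y <;> simp [UnitizationForm.leftAct_apply] <;> ring)
    (fun c b ψ => by
      ext x y <;> simp [UnitizationForm.leftAct_apply] <;> ring)) 3
    UnitizationForm.norm_leftAct_le
  rsmul := LinearMap.mkContinuous₂ (LinearMap.mk₂ ℂ UnitizationForm.rightAct
    (fun a b ψ => by
      ext x y <;> simp [UnitizationForm.rightAct_apply, add_mul, UnitizationForm.map_inr_add])
    (fun c b ψ => by
      ext x y <;> simp [UnitizationForm.rightAct_apply, smul_mul_assoc,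
        UnitizationForm.map_inr_smul])
    (fun b ψ χ => by
      ext x y <;> simp [UnitizationForm.rightAct_apply])
    (fun c b ψ => by
      ext x y <;> simp [UnitizationForm.rightAct_apply])) 2
    UnitizationForm.norm_rightAct_le
  mul_lsmul := UnitizationForm.mul_leftAct
  rsmul_mul := UnitizationForm.mul_rightAct
  lsmul_rsmul := UnitizationForm.leftAct_rightAct

theorem unitizationFormBimodule_lsmul (b : B) (ψ : UnitizationForm B) :
    (unitizationFormBimodule B).lsmul b ψ = ψ.leftAct b := rfl

theorem unitizationFormBimodule_rsmul (b : B) (ψ : UnitizationForm B) :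
    (unitizationFormBimodule B).rsmul b ψ = ψ.rightAct b := rfl

/-- Reading the evaluation at (x, y) as x ⊗ y - xy ⊗ 1, the two actions are dual to multiplication
by b on the two sides of the kernel of the product map. The derivation b ↦ 1 ⊗ b - b ⊗ 1 is then
inner, implemented by Ψ, and 1 ⊗ 1 + Ψ commutes with `B`. -/
theorem exists_virtual_diagonal (hB : IsAmenableBanachAlgebra B) :
    ∃ Ψ : StrongDual ℂ (UnitizationForm B), ∀ (b : B) (ψ : UnitizationForm B),
      ψ (1, 0) b = Ψ (ψ.rightAct b) - Ψ (ψ.leftAct b) := by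
  obtain ⟨Ψ, h⟩ := hB (UnitizationForm B) (unitizationFormBimodule B) (evalForm B (1, 0)) (by
    intro a b ψ
    simp [unitizationFormBimodule_lsmul, unitizationFormBimodule_rsmul,
      UnitizationForm.leftAct_apply, UnitizationForm.rightAct_apply])
  exact ⟨Ψ, fun b ψ => h b ψ⟩

/-- The map `T ↦ T ∘ (ψ ↦ ψ · b - b · ψ)`. -/
def formCommutator (b : B) :
    StrongDual ℂ (UnitizationForm B) →L[ℂ] StrongDual ℂ (UnitizationForm B) :=
  (ContinuousLinearMap.compL ℂ (UnitizationForm B) (UnitizationForm B) ℂ).flip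
    ((unitizationFormBimodule B).rsmul b - (unitizationFormBimodule B).lsmul b)

theorem formCommutator_apply (b : B) (T : StrongDual ℂ (UnitizationForm B))
    (ψ : UnitizationForm B) :
    formCommutator b T ψ = T (ψ.rightAct b) - T (ψ.leftAct b) := by
  simp only [formCommutator, ContinuousLinearMap.flip_apply, ContinuousLinearMap.compL_apply,
    ContinuousLinearMap.comp_apply, sub_apply, map_sub]
  rfl

theorem formCommutator_evalForm (b : B) (x : ℂ × B) (y : B) :
    formCommutator b (evalForm B x y) =
      evalForm B (0, x.1 • b + b * x.2) y -
        (evalForm B x (y * b) - evalForm B (0, x.1 • y + x.2 * y) b) := by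
  ext ψ
  rw [formCommutator_apply]
  rfl

variable (B) in
/-- Evaluations at pairs with product of norms at most `K`. -/
def boundedEvalForms (K : ℝ) : Set (StrongDual ℂ (UnitizationForm B)) :=
  {T | ∃ x y, ‖x‖ * ‖y‖ ≤ K ∧ T = evalForm B x y}

/-- Hahn–Banach: a functional separating the tuple from the convex set is tested on evaluations
only, so it acts through a single form χ, on which Ψ exceeds the bound allowed by its own norm.
Treating a finite family of b simultaneously gives norm approximation, not just weak approximation.
-/
theorem mem_closure_formCommutator {Ψ : StrongDual ℂ (UnitizationForm B)}
    (hΨ : ∀ (b : B) (ψ : UnitizationForm B),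
      ψ (1, 0) b = Ψ (ψ.rightAct b) - Ψ (ψ.leftAct b)) {ι : Type u} [Fintype ι] (c : ι → B) :
    (fun i => evalForm B (1, 0) (c i)) ∈
      closure ((fun T i => formCommutator (c i) T) ''
        convexHull ℝ (boundedEvalForms B (‖Ψ‖ + 1))) := by
  classical
  by_contra hw
  have hconv : Convex ℝ (closure ((fun T i => formCommutator (c i) T) ''
        convexHull ℝ (boundedEvalForms B (‖Ψ‖ + 1)))) :=
    ((convex_convexHull ℝ _).is_linear_image
      ⟨fun a b => funext fun i => map_add _ a b,
        fun r a => funext fun i => (formCommutator (c i)).map_smul_of_tower r a⟩).closure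
  obtain ⟨Λ, u, hu, hwu⟩ :=
    RCLike.geometric_hahn_banach_closed_point (𝕜 := ℂ) hconv isClosed_closure hw
  let lam (i : ι) : StrongDual ℂ (StrongDual ℂ (UnitizationForm B)) :=
    Λ.comp (ContinuousLinearMap.single ℂ (fun _ : ι => StrongDual ℂ (UnitizationForm B)) i)
  have hΛ (v : ι → StrongDual ℂ (UnitizationForm B)) : Λ v = ∑ i, lam i (v i) := by
    conv_lhs => rw [← Finset.univ_sum_single v, map_sum]
    rfl
  -- χ is the separating functional pulled back along the commutators: its values at pairs are the
  -- values on the convex set, and Ψ χ is the value at the tuple to be approximated.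
  let χ : UnitizationForm B :=
    ∑ i, ((formOfBidual (lam i)).rightAct (c i) - (formOfBidual (lam i)).leftAct (c i))
  have hχw : Λ (fun i => evalForm B (1, 0) (c i)) = Ψ χ := by
    rw [hΛ, map_sum]
    refine Finset.sum_congr rfl fun i _ => ?_
    rw [map_sub, ← hΨ, formOfBidual_apply]
  have hχ (x y) : Λ (fun i => formCommutator (c i) (evalForm B x y)) = χ x y := by
    rw [hΛ]
    simp only [χ, _root_.sum_apply, sub_apply]
    refine Finset.sum_congr rfl fun i _ => ?_
    rw [UnitizationForm.rightAct_apply, UnitizationForm.leftAct_apply, formCommutator_evalForm,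
      map_sub, map_sub]
    rfl
  have hχu : ‖χ‖ ≤ u / (‖Ψ‖ + 1) := by
    refine UnitizationForm.norm_le_of_re_lt (by positivity) fun x y hxy => ?_
    rw [← hχ]
    exact hu _ (subset_closure ⟨_, subset_convexHull ℝ _ ⟨x, y, hxy, rfl⟩, rfl⟩)
  have h3 : (Ψ χ).re ≤ ‖Ψ‖ * ‖χ‖ := (Complex.re_le_norm _).trans (Ψ.le_opNorm χ)
  rw [le_div_iff₀ (by positivity)] at hχu
  have hwu' : u < (Ψ χ).re := by rw [← hχw]; exact hwu
  linarith [norm_nonneg χ]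

/-- An amenable Banach algebra `B` has approximate diagonals in its unitization, of the form
`1 ⊗ 1 + ∑ k, (x k ⊗ y k - x k * y k ⊗ 1)` with `∑ k, ‖x k‖ * ‖y k‖` uniformly bounded. -/
theorem exists_approximate_diagonal (hB : IsAmenableBanachAlgebra B) :
    ∃ K : ℝ, 0 ≤ K ∧ ∀ (F : Finset B) (ε : ℝ), 0 < ε →
      ∃ (κ : Type) (_ : Fintype κ) (x : κ → ℂ × B) (y : κ → B),
        ∑ k, ‖x k‖ * ‖y k‖ ≤ K ∧ ∀ b ∈ F, ∀ ψ : UnitizationForm B,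
          ‖ψ (1, 0) b - ∑ k, (ψ.rightAct b (x k) (y k) - ψ.leftAct b (x k) (y k))‖ ≤ ε * ‖ψ‖ := by
  obtain ⟨Ψ, hΨ⟩ := exists_virtual_diagonal hB
  refine ⟨‖Ψ‖ + 1, by positivity, fun F ε hε => ?_⟩
  obtain ⟨_, ⟨T, hT, rfl⟩, hd⟩ := Metric.mem_closure_iff.1
    (mem_closure_formCommutator hΨ (fun b : F => (b : B))) ε hε
  obtain ⟨κ, _, c, z, hc, hc1, hz, rfl⟩ := mem_convexHull_iff_exists_fintype.1 hT
  choose x y hxy hz using hz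
  -- The convex weights are absorbed into the first legs; as they sum to 1, the total norm stays at
  -- most ‖Ψ‖ + 1.
  refine ⟨κ, inferInstance, fun k => (c k : ℂ) • x k, y, ?_, fun b hb ψ => ?_⟩
  · calc ∑ k, ‖(c k : ℂ) • x k‖ * ‖y k‖ ≤ ∑ k, c k * (‖Ψ‖ + 1) := by
          refine Finset.sum_le_sum fun k _ => ?_
          rw [norm_smul, Complex.norm_real, Real.norm_of_nonneg (hc k), mul_assoc]
          exact mul_le_mul_of_nonneg_left (hxy k) (hc k)
      _ = ‖Ψ‖ + 1 := by rw [← Finset.sum_mul, hc1, one_mul]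
  · have h1 : ‖evalForm B (1, 0) b - formCommutator b (∑ k, c k • z k)‖ ≤ ε := by
      rw [← dist_eq_norm]
      exact ((dist_pi_lt_iff hε).1 hd ⟨b, hb⟩).le
    have h2 : ψ (1, 0) b - ∑ k, (ψ.rightAct b ((c k : ℂ) • x k) (y k)
          - ψ.leftAct b ((c k : ℂ) • x k) (y k)) =
        (evalForm B (1, 0) b - formCommutator b (∑ k, c k • z k)) ψ := by
      rw [sub_apply]
      congr 1
      rw [map_sum, _root_.sum_apply]
      refine Finset.sum_congr rfl fun k _ => ?_
      rw [formCommutator_apply, hz]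
      simp
    rw [h2]
    exact (ContinuousLinearMap.le_opNorm _ _).trans (by gcongr)

end ApproximateDiagonal

end BanachCyclic

end

noncomputable section

namespace BanachCyclic

/-! ### Index arithmetic of the cyclic rotation -/

section Rotation

theorem finRotate_castSucc {n : ℕ} (i : Fin n) : finRotate (n + 1) i.castSucc = i.succ := by
  rw [finRotate_of_lt (by simp)]; rfl

theorem finRotate_symm_succ {n : ℕ} (i : Fin n) : (finRotate (n + 1)).symm i.succ = i.castSucc := by
  rw [Equiv.symm_apply_eq, finRotate_castSucc]

theorem finRotate_symm_zero {n : ℕ} : (finRotate (n + 1)).symm 0 = Fin.last n := by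
  rw [Equiv.symm_apply_eq, finRotate_last]

theorem finRotate_symm_castSucc {n : ℕ} (i : Fin (n + 1)) :
    (finRotate (n + 2)).symm i.castSucc =
      i.castSucc.succAbove ((finRotate (n + 1)).symm i) := by
  cases i using Fin.cases with
  | zero =>
    rw [Fin.castSucc_zero, finRotate_symm_zero, finRotate_symm_zero, Fin.zero_succAbove,
      Fin.succ_last]
  | succ i =>
    rw [← Fin.succ_castSucc, finRotate_symm_succ, finRotate_symm_succ,
      Fin.succAbove_of_castSucc_lt]
    exact Fin.castSucc_lt_castSucc_iff.2 (Fin.castSucc_lt_succ)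

theorem finRotate_symm_succAbove {n : ℕ} {i q : Fin (n + 1)} (h : q ≠ i) :
    (finRotate (n + 2)).symm (i.castSucc.succAbove q) =
      i.castSucc.succAbove ((finRotate (n + 1)).symm q) := by
  cases q using Fin.cases with
  | zero =>
    have h0 : (0 : ℕ) < i := Nat.pos_of_ne_zero fun h' => h (Fin.ext h'.symm)
    rw [Fin.succAbove_of_castSucc_lt _ _ (Fin.lt_def.2 (by simpa only [Fin.val_castSucc, Fin.val_zero] using h0)), Fin.castSucc_zero,
      finRotate_symm_zero, finRotate_symm_zero, Fin.succAbove_of_le_castSucc _ _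
        (Fin.le_def.2 (by simp; omega)), Fin.succ_last]
  | succ q =>
    rw [finRotate_symm_succ]
    rcases lt_or_gt_of_ne h with h' | h'
    · rw [Fin.lt_def, Fin.val_succ] at h'
      rw [Fin.succAbove_of_castSucc_lt _ _ (Fin.lt_def.2 (by simp; omega)), ← Fin.succ_castSucc,
        finRotate_symm_succ, Fin.succAbove_of_castSucc_lt _ _ (Fin.lt_def.2 (by simp; omega))]
    · rw [Fin.lt_def, Fin.val_succ] at h'
      rw [Fin.succAbove_of_le_castSucc _ _ (Fin.le_def.2 (by simp; omega)), finRotate_symm_succ,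
        Fin.succAbove_of_le_castSucc _ _ (Fin.le_def.2 (by simp; omega)), Fin.succ_castSucc]

end Rotation

/-! ### Families of operators acting at the cyclic junctions -/

variable {A : Type u} [NonUnitalNormedRing A] [NormedSpace ℂ A]
  {ι : Type*} [Fintype ι]

/-- The cochain `∑ k, f(L (k n) (ρ 0 (k 0) a₀), L (k 0) (ρ 1 (k 1) a₁), …)`: for each `j`, the
family `∑ k, ρ j k ⊗ L k` acts on the `j`-th cyclic junction of the arguments. -/
def junctionSum (L : ι → A →L[ℂ] A) {n : ℕ} (ρ : Fin (n + 1) → ι → A →L[ℂ] A) (f : Cochain A n) :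
    Cochain A n :=
  ∑ k : Fin (n + 1) → ι, f.compContinuousLinearMap
    fun j => (L (k ((finRotate (n + 1)).symm j))).comp (ρ j (k j))

variable (L : ι → A →L[ℂ] A) {n : ℕ}

theorem junctionSum_apply (ρ : Fin (n + 1) → ι → A →L[ℂ] A) (f : Cochain A n)
    (a : Fin (n + 1) → A) :
    junctionSum L ρ f a = ∑ k : Fin (n + 1) → ι,
      f fun j => L (k ((finRotate (n + 1)).symm j)) (ρ j (k j) (a j)) := by
  simp [junctionSum, _root_.sum_apply]

theorem junctionSum_add (ρ : Fin (n + 1) → ι → A →L[ℂ] A) (f g : Cochain A n) :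
    junctionSum L ρ (f + g) = junctionSum L ρ f + junctionSum L ρ g := by
  ext a
  simp [junctionSum_apply, Finset.sum_add_distrib]

theorem junctionSum_smul (ρ : Fin (n + 1) → ι → A →L[ℂ] A) (c : ℂ) (f : Cochain A n) :
    junctionSum L ρ (c • f) = c • junctionSum L ρ f := by
  ext a
  simp [junctionSum_apply, Finset.mul_sum]

/-- Rotating the left factors back regroups the product by junctions instead of arguments, and the
sum over all index tuples then factorises. -/
theorem norm_junctionSum_le (ρ : Fin (n + 1) → ι → A →L[ℂ] A) (f : Cochain A n) :
    ‖junctionSum L ρ f‖ ≤ ‖f‖ * ∏ j, ∑ k, ‖L k‖ * ‖ρ j k‖ := by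
  rw [Finset.prod_univ_sum, Finset.mul_sum, Fintype.piFinset_univ]
  refine (norm_sum_le _ _).trans (Finset.sum_le_sum fun k _ => ?_)
  refine (f.norm_compContinuousLinearMap_le _).trans ?_
  refine mul_le_mul_of_nonneg_left ?_ (norm_nonneg f)
  rw [Finset.prod_mul_distrib, ← Equiv.prod_comp (finRotate (n + 1)).symm (fun j => ‖L (k j)‖),
    ← Finset.prod_mul_distrib]
  exact Finset.prod_le_prod (fun _ _ => norm_nonneg _)
    fun j _ => ContinuousLinearMap.opNorm_comp_le _ _

/-- A permutation commuting with the rotation preserves cyclic adjacency, so it only relabels the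
junctions. -/
theorem junctionSum_domDomCongr (ρ : Fin (n + 1) → ι → A →L[ℂ] A) (f : Cochain A n)
    (τ : Equiv.Perm (Fin (n + 1)))
    (hτ : ∀ j, (finRotate (n + 1)).symm (τ j) = τ ((finRotate (n + 1)).symm j)) :
    junctionSum L ρ (f.domDomCongr τ) = (junctionSum L (fun j => ρ (τ j)) f).domDomCongr τ := by
  ext a
  rw [ContinuousMultilinearMap.domDomCongr_apply, junctionSum_apply, junctionSum_apply,
    ← (τ.arrowCongr (Equiv.refl ι)).sum_comp]
  refine Finset.sum_congr rfl fun k _ => ?_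
  change f _ = f _
  congr 1
  ext j
  simp only [Equiv.arrowCongr_apply, Function.comp_apply, Equiv.coe_refl, id,
    Equiv.symm_apply_apply]
  rw [hτ, Equiv.symm_apply_apply]

theorem junctionSum_finRotate (R : ι → A →L[ℂ] A) (f : Cochain A n) :
    junctionSum L (fun _ => R) (f.domDomCongr (finRotate (n + 1))) =
      (junctionSum L (fun _ => R) f).domDomCongr (finRotate (n + 1)) :=
  junctionSum_domDomCongr L _ f _ fun j => by simp

variable [IsScalarTower ℂ A A] [SMulCommClass ℂ A A]

-- When two arguments are multiplied, the junction between them becomes internal: its two legs meet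
-- and sum to c times the product, and the right multiplier at the next junction pulls out of it.
-- For a diagonal with product 1 the junction disappears (c = 1); for a direction with product 0 the
-- whole term dies (c = 0).
variable {L} in
theorem junctionSum_face (hL : ∀ k a b, L k (a * b) = L k a * b)
    (ρ : Fin (n + 2) → ι → A →L[ℂ] A) (i : Fin (n + 1)) (c : ℂ)
    (hρ : ∀ k a b, ρ i.succ k (a * b) = a * ρ i.succ k b)
    (hc : ∀ a b, ∑ k, ρ i.castSucc k a * L k b = c • (a * b)) (f : Cochain A n) :
    junctionSum L ρ (face i f) =
      c • face i (junctionSum L (fun j => ρ (i.castSucc.succAbove j)) f) := by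
  ext a
  rw [_root_.smul_apply]
  change _ = c • junctionSum L (fun j => ρ (i.castSucc.succAbove j)) f
    (i.castSucc.contractNth (· * ·) a)
  rw [junctionSum_apply, junctionSum_apply,
    ← (Fin.insertNthEquiv (fun _ => ι) i.castSucc).sum_comp, Fintype.sum_prod_type_right,
    Finset.smul_sum]
  refine Finset.sum_congr rfl fun k _ => ?_
  set w : Fin (n + 1) → A := fun j => L (k ((finRotate (n + 1)).symm j))
    (ρ (i.castSucc.succAbove j) (k j) (i.castSucc.contractNth (· * ·) a j)) with hw
  have hs : i.castSucc.succAbove i = i.succ := Fin.succAbove_castSucc_self i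
  have key (κ : ι) : (face i f) (fun j => L ((Fin.insertNthEquiv (fun _ => ι) i.castSucc) (κ, k)
      ((finRotate (n + 1 + 1)).symm j)) (ρ j ((Fin.insertNthEquiv (fun _ => ι) i.castSucc) (κ, k) j)
        (a j))) =
      f.toContinuousLinearMap w i (L (k ((finRotate (n + 1)).symm i))
        (ρ i.castSucc κ (a i.castSucc) * L κ (ρ i.succ (k i) (a i.succ)))) := by
    change f _ = f _
    congr 1
    ext q
    rcases eq_or_ne q i with rfl | hq
    · rw [Function.update_self, Fin.contractNth_apply_of_eq _ _ _ _ rfl, hL]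
      congr 1
      · rw [finRotate_symm_castSucc]
        simp only [Fin.insertNthEquiv_apply, Fin.insertNth_apply_same,
          Fin.insertNth_apply_succAbove]
      · rw [finRotate_symm_succ]
        simp only [Fin.insertNthEquiv_apply, Fin.insertNth_apply_same]
        rw [← hs, Fin.insertNth_apply_succAbove]
    · rw [Function.update_of_ne hq, hw]
      have h1 (v : Fin (n + 2) → A) :
          i.castSucc.contractNth (· * ·) v q = v (i.castSucc.succAbove q) := by
        rcases lt_or_gt_of_ne hq with h | h
        · rw [Fin.contractNth_apply_of_lt _ _ _ _ h,
            Fin.succAbove_of_castSucc_lt _ _ (Fin.castSucc_lt_castSucc_iff.2 h)]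
        · rw [Fin.contractNth_apply_of_gt _ _ _ _ h,
            Fin.succAbove_of_le_castSucc _ _ (Fin.castSucc_le_castSucc_iff.2 h.le)]
      rw [h1]
      simp only [h1]
      rw [finRotate_symm_succAbove hq]
      simp only [Fin.insertNthEquiv_apply, Fin.insertNth_apply_succAbove]
  simp only [key]
  rw [← map_sum, ← map_sum, hc, map_smul, map_smul]
  congr 1
  change f _ = f _
  congr 1
  rw [Function.update_eq_self_iff, hw, ← hρ]
  beta_reduce
  rw [hs, Fin.contractNth_apply_of_eq _ _ _ _ rfl]

end BanachCyclic

end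

noncomputable section

namespace BanachCyclic

/-! ### The signed shift, its norm operator and the faces -/

section Cyclic

variable {A : Type u} [NonUnitalNormedRing A]

theorem contractNth_comp_finRotate {n : ℕ} (i : Fin n) (a : Fin (n + 2) → A) :
    (i.castSucc.castSucc.contractNth (· * ·) (a ∘ finRotate (n + 2)) : Fin (n + 1) → A) =
      (i.succ.castSucc.contractNth (· * ·) a) ∘ finRotate (n + 1) := by
  ext q
  cases q using Fin.lastCases with
  | last =>
    rw [Function.comp_apply, finRotate_last,
      Fin.contractNth_apply_of_gt _ _ _ _ (by simp), Fin.contractNth_apply_of_lt _ _ _ _ (by simp)]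
    simp [Fin.succ_last]
  | cast q =>
    rw [Function.comp_apply, finRotate_castSucc]
    rcases lt_trichotomy (q : ℕ) (i : ℕ) with h | h | h
    · rw [Fin.contractNth_apply_of_lt _ _ _ _ (by simpa using h),
        Fin.contractNth_apply_of_lt _ _ _ _ (by simpa using h), Function.comp_apply,
        finRotate_castSucc, Fin.succ_castSucc]
    · rw [Fin.contractNth_apply_of_eq _ _ _ _ (by simpa using h),
        Fin.contractNth_apply_of_eq _ _ _ _ (by simpa using h), Function.comp_apply,
        Function.comp_apply, finRotate_castSucc, Fin.succ_castSucc, finRotate_castSucc]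
    · rw [Fin.contractNth_apply_of_gt _ _ _ _ (by simpa using h),
        Fin.contractNth_apply_of_gt _ _ _ _ (by simpa using h), Function.comp_apply,
        Fin.succ_castSucc, finRotate_castSucc]

theorem contractNth_last_comp_finRotate {n : ℕ} (a : Fin (n + 2) → A) :
    ((Fin.last n).castSucc.contractNth (· * ·) (a ∘ finRotate (n + 2)) : Fin (n + 1) → A) =
      ((0 : Fin (n + 1)).castSucc.contractNth (· * ·) (a ∘ (finRotate (n + 2)).symm)) ∘
        finRotate (n + 1) := by
  ext q
  cases q using Fin.lastCases with
  | last =>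
    rw [Function.comp_apply, finRotate_last,
      Fin.contractNth_apply_of_eq _ _ _ _ (by simp), Fin.contractNth_apply_of_eq _ _ _ _ (by simp),
      Function.comp_apply, Function.comp_apply, Function.comp_apply, Function.comp_apply,
      Fin.castSucc_zero, finRotate_symm_zero, finRotate_symm_succ, finRotate_castSucc,
      Fin.succ_last, finRotate_last]
    simp
  | cast q =>
    rw [Function.comp_apply, finRotate_castSucc,
      Fin.contractNth_apply_of_lt _ _ _ _ (by simp), Fin.contractNth_apply_of_gt _ _ _ _ (by simp),
      Function.comp_apply, Function.comp_apply, finRotate_castSucc, finRotate_symm_succ,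
      Fin.succ_castSucc]

variable [NormedSpace ℂ A]

variable (A) in
/-- The signed cyclic shift as a linear map. -/
def shift (n : ℕ) : Module.End ℂ (Cochain A n) where
  toFun := cyclicShift n
  map_add' f g := by ext; simp [cyclicShift, mul_add]
  map_smul' c f := by ext; simp [cyclicShift, mul_left_comm]

theorem shift_apply {n : ℕ} (f : Cochain A n) (a : Fin (n + 1) → A) :
    shift A n f a = (-1) ^ n * f (a ∘ finRotate (n + 1)) := rfl

theorem mem_cyclicCochains_iff {n : ℕ} {f : Cochain A n} :
    f ∈ cyclicCochains A n ↔ shift A n f = f := Iff.rfl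

theorem norm_shift {n : ℕ} (f : Cochain A n) : ‖shift A n f‖ = ‖f‖ := by
  change ‖cyclicShift n f‖ = ‖f‖
  rw [cyclicShift, norm_smul, norm_pow, norm_neg, norm_one, one_pow, one_mul]
  exact (ContinuousMultilinearMap.domDomCongrₗᵢ ℂ A ℂ (finRotate (n + 1))).norm_map f

theorem shift_pow_apply {n : ℕ} (f : Cochain A n) (i : ℕ) (a : Fin (n + 1) → A) :
    (shift A n ^ i) f a = ((-1) ^ n) ^ i * f (a ∘ (finRotate (n + 1) ^ i : Equiv.Perm _)) := by
  induction i generalizing a with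
  | zero => simp
  | succ i ih =>
    rw [pow_succ', Module.End.mul_apply, shift_apply, ih, pow_succ' (finRotate (n + 1)),
      Equiv.Perm.coe_mul, pow_succ']
    rw [Function.comp_assoc, mul_assoc]

theorem finRotate_pow_card (n : ℕ) : finRotate (n + 1) ^ (n + 1) = 1 := by
  have h (i : ℕ) (j : Fin (n + 1)) :
      ((finRotate (n + 1) ^ i : Equiv.Perm _) j : ℕ) = (j + i) % (n + 1) := by
    induction i with
    | zero => simp [Nat.mod_eq_of_lt j.is_lt]
    | succ i ih =>
      rw [pow_succ', Equiv.Perm.mul_apply, finRotate_apply, Fin.val_add, ih, Fin.val_one',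
        ← Nat.add_mod, add_assoc]
  ext j
  rw [h]
  simp [Nat.mod_eq_of_lt j.is_lt]

theorem shift_pow_card (n : ℕ) : shift A n ^ (n + 1) = 1 := by
  ext f a
  rw [shift_pow_apply, finRotate_pow_card, ← pow_mul, (Nat.even_mul_succ_self n).neg_one_pow]
  simp

variable (A) in
/-- The sum of all powers of the signed cyclic shift. -/
def cyclicNorm (n : ℕ) : Module.End ℂ (Cochain A n) := ∑ i ∈ Finset.range (n + 1), shift A n ^ i

theorem cyclicNorm_apply {n : ℕ} (f : Cochain A n) :
    cyclicNorm A n f = ∑ i ∈ Finset.range (n + 1), (shift A n ^ i) f := by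
  simp [cyclicNorm]

theorem shift_mul_cyclicNorm (n : ℕ) : shift A n * cyclicNorm A n = cyclicNorm A n := by
  rw [cyclicNorm, Finset.mul_sum]
  simp only [← pow_succ']
  rw [Finset.sum_range_succ, Finset.sum_range_succ', shift_pow_card, pow_zero]

theorem cyclicNorm_mul_shift (n : ℕ) : cyclicNorm A n * shift A n = cyclicNorm A n := by
  rw [cyclicNorm, Finset.sum_mul]
  simp only [← pow_succ]
  rw [Finset.sum_range_succ, Finset.sum_range_succ', shift_pow_card, pow_zero]

theorem cyclicNorm_mul_shift_pow (n i : ℕ) : cyclicNorm A n * shift A n ^ i = cyclicNorm A n := by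
  induction i with
  | zero => simp
  | succ i ih => rw [pow_succ, ← mul_assoc, ih, cyclicNorm_mul_shift]

theorem cyclicNorm_mem {n : ℕ} (f : Cochain A n) : cyclicNorm A n f ∈ cyclicCochains A n := by
  rw [mem_cyclicCochains_iff, ← Module.End.mul_apply, shift_mul_cyclicNorm]

theorem shift_pow_of_mem {n : ℕ} {f : Cochain A n} (hf : f ∈ cyclicCochains A n) (i : ℕ) :
    (shift A n ^ i) f = f := by
  induction i with
  | zero => simp
  | succ i ih => rw [pow_succ', Module.End.mul_apply, ih, mem_cyclicCochains_iff.1 hf]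

theorem norm_shift_pow {n : ℕ} (f : Cochain A n) (i : ℕ) : ‖(shift A n ^ i) f‖ = ‖f‖ := by
  induction i with
  | zero => simp
  | succ i ih => rw [pow_succ', Module.End.mul_apply, norm_shift, ih]

theorem norm_cyclicNorm_le {n : ℕ} (f : Cochain A n) : ‖cyclicNorm A n f‖ ≤ (n + 1) * ‖f‖ := by
  rw [cyclicNorm_apply]
  refine (norm_sum_le _ _).trans ?_
  simp [norm_shift_pow]

variable [IsScalarTower ℂ A A] [SMulCommClass ℂ A A]

variable (A) in
/-- The `i`-th signed face map, for `0 ≤ i ≤ n + 1`. -/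
def signedFace (n i : ℕ) : Cochain A n →ₗ[ℂ] Cochain A (n + 1) where
  toFun f := (-1 : ℂ) ^ i • if h : i < n + 1 then face ⟨i, h⟩ f else lastFace f
  map_add' f g := by
    split_ifs
    · rw [face_add, smul_add]
    · rw [lastFace_add, smul_add]
  map_smul' c f := by
    split_ifs
    · rw [face_smul, smul_comm]; rfl
    · rw [lastFace_smul, smul_comm]; rfl

theorem signedFace_of_lt {n i : ℕ} (h : i < n + 1) (f : Cochain A n) :
    signedFace A n i f = (-1 : ℂ) ^ i • face ⟨i, h⟩ f := by
  simp [signedFace, h]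

theorem signedFace_last {n : ℕ} (f : Cochain A n) :
    signedFace A n (n + 1) f = (-1 : ℂ) ^ (n + 1) • lastFace f := by
  simp [signedFace]

theorem coboundary_eq_sum {n : ℕ} (f : Cochain A n) :
    coboundary A n f = ∑ i ∈ Finset.range (n + 2), signedFace A n i f := by
  rw [Finset.sum_range_succ, Finset.sum_range, signedFace_last]
  simp only [signedFace_of_lt (Fin.is_lt _)]
  rfl

theorem face_comp_finRotate {n : ℕ} (i : Fin n) (f : Cochain A n) (a : Fin (n + 2) → A) :
    face i.castSucc f (a ∘ finRotate (n + 2)) =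
      face i.succ (f.domDomCongr (finRotate (n + 1))) a :=
  congrArg f (contractNth_comp_finRotate i a)

theorem face_last_comp_finRotate {n : ℕ} (f : Cochain A n) (a : Fin (n + 2) → A) :
    face (Fin.last n) f (a ∘ finRotate (n + 2)) =
      lastFace (f.domDomCongr (finRotate (n + 1))) a :=
  congrArg f (contractNth_last_comp_finRotate a)

/-- The signs of δ are such that the shift carries each signed face to the next; hence all faces are
obtained from face 0. -/
theorem shift_signedFace {n i : ℕ} (hi : i ≤ n) (f : Cochain A n) :
    shift A (n + 1) (signedFace A n i f) = signedFace A n (i + 1) (shift A n f) := by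
  ext a
  rw [shift_apply, signedFace_of_lt (Nat.lt_succ_of_le hi), _root_.smul_apply,
    show shift A n f = (-1 : ℂ) ^ n • f.domDomCongr (finRotate (n + 1)) from rfl]
  rcases hi.lt_or_eq with h | rfl
  · rw [signedFace_of_lt (Nat.succ_lt_succ h), face_smul, _root_.smul_apply, _root_.smul_apply,
      show (⟨i, Nat.lt_succ_of_le hi⟩ : Fin (n + 1)) = (⟨i, h⟩ : Fin n).castSucc from rfl,
      face_comp_finRotate,
      show (⟨i + 1, Nat.succ_lt_succ h⟩ : Fin (n + 1)) = (⟨i, h⟩ : Fin n).succ from rfl]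
    simp only [smul_eq_mul, Nat.succ_eq_add_one]
    ring
  · rw [signedFace_last, lastFace_smul, _root_.smul_apply, _root_.smul_apply,
      show (⟨i, Nat.lt_succ_of_le hi⟩ : Fin (i + 1)) = Fin.last i from rfl,
      face_last_comp_finRotate, smul_eq_mul, smul_eq_mul]

theorem shift_pow_signedFace_zero {n i : ℕ} (hi : i ≤ n + 1) (f : Cochain A n) :
    (shift A (n + 1) ^ i) (signedFace A n 0 f) = signedFace A n i ((shift A n ^ i) f) := by
  induction i with
  | zero => simp
  | succ i ih =>
    rw [pow_succ', Module.End.mul_apply, ih (by omega), shift_signedFace (by omega), pow_succ',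
      Module.End.mul_apply]

theorem coboundary_of_mem {n : ℕ} {f : Cochain A n} (hf : f ∈ cyclicCochains A n) :
    coboundary A n f = cyclicNorm A (n + 1) (face 0 f) := by
  have h0 : face 0 f = signedFace A n 0 f := by
    rw [signedFace_of_lt (Nat.succ_pos n), pow_zero, one_smul]; rfl
  rw [coboundary_eq_sum, cyclicNorm_apply, h0]
  refine Finset.sum_congr rfl fun i hi => ?_
  rw [shift_pow_signedFace_zero (Nat.le_of_lt_succ (Finset.mem_range.1 hi)), shift_pow_of_mem hf]

/-- The cyclic norm intertwines the bar differential and the coboundary. -/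
theorem cyclicNorm_sum_signedFace {n : ℕ} (f : Cochain A n) :
    cyclicNorm A (n + 1) (∑ i ∈ Finset.range (n + 1), signedFace A n i f) =
      coboundary A n (cyclicNorm A n f) := by
  have h0 (g : Cochain A n) : face 0 g = signedFace A n 0 g := by
    rw [signedFace_of_lt (Nat.succ_pos n), pow_zero, one_smul]; rfl
  rw [coboundary_of_mem (cyclicNorm_mem f), h0, map_sum]
  -- N absorbs shifts, so face i may be replaced by a face 0. The exponent n - i + 1 makes the total
  -- shift on f equal to n + 1, which is the identity.
  have h1 : ∀ i ∈ Finset.range (n + 1), cyclicNorm A (n + 1) (signedFace A n i f) =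
      cyclicNorm A (n + 1) (signedFace A n 0 ((shift A n ^ (n - i + 1)) f)) := by
    intro i hi
    have hi' := Finset.mem_range.1 hi
    conv_rhs => rw [← cyclicNorm_mul_shift_pow (n + 1) i]
    rw [Module.End.mul_apply, shift_pow_signedFace_zero hi'.le, ← Module.End.mul_apply, ← pow_add,
      show i + (n - i + 1) = n + 1 by omega, shift_pow_card, Module.End.one_apply]
  rw [Finset.sum_congr rfl h1, ← map_sum, ← map_sum]
  have h2 := Finset.sum_range_reflect (fun i => (shift A n ^ (i + 1)) f) (n + 1)
  simp only [Nat.add_sub_cancel] at h2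
  rw [h2]
  congr 2
  conv_rhs => rw [← cyclicNorm_mul_shift, Module.End.mul_apply, cyclicNorm_apply]
  simp only [pow_succ, Module.End.mul_apply]

variable {ι : Type*} [Fintype ι] {L : ι → A →L[ℂ] A} {n : ℕ}

omit [IsScalarTower ℂ A A] [SMulCommClass ℂ A A] in
theorem junctionSum_shift (R : ι → A →L[ℂ] A) (f : Cochain A n) :
    junctionSum L (fun _ => R) (shift A n f) = shift A n (junctionSum L (fun _ => R) f) := by
  change junctionSum L _ ((-1 : ℂ) ^ n • f.domDomCongr (finRotate (n + 1))) = _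
  rw [junctionSum_smul, junctionSum_finRotate]
  rfl

end Cyclic

end BanachCyclic

end

noncomputable section

namespace BanachCyclic

/-! ### The segment from the trivial diagonal and its derivative -/

section Path

variable {A : Type u} [NonUnitalNormedRing A] [NormedSpace ℂ A]

variable (A) in
/-- A diagonal of multipliers `∑ k, (base k + dir k) ⊗ left k` of `A`, where `base` is trivial: it
represents `1 ⊗ 1`. -/
structure MultiplierDiagonal (ι : Type*) [Fintype ι] where
  /-- the left multipliers -/
  left : ι → A →L[ℂ] A
  /-- the right multipliers of the trivial diagonal -/
  base : ι → A →L[ℂ] A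
  /-- the right multipliers of the difference with the trivial diagonal -/
  dir : ι → A →L[ℂ] A
  /-- the index of the term `1 ⊗ 1` -/
  unit : ι
  left_unit : left unit = ContinuousLinearMap.id ℂ A
  base_unit : base unit = ContinuousLinearMap.id ℂ A
  base_of_ne : ∀ k, k ≠ unit → base k = 0
  left_mul : ∀ k a b, left k (a * b) = left k a * b
  dir_mul : ∀ k a b, dir k (a * b) = a * dir k b
  sum_dir : ∀ a b, ∑ k, dir k a * left k b = 0

theorem continuous_junctionSum {ι : Type*} [Fintype ι] {X : Type*} [TopologicalSpace X]
    (L : ι → A →L[ℂ] A) {n : ℕ} {ρ : X → Fin (n + 1) → ι → A →L[ℂ] A}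
    (hρ : ∀ j k, Continuous fun x => ρ x j k) (f : Cochain A n) :
    Continuous fun x => junctionSum L (ρ x) f :=
  continuous_finsetSum _ fun k _ =>
    (ContinuousMultilinearMap.compContinuousLinearMapLRight (𝕜 := ℂ)
      (E := fun _ : Fin (n + 1) => A) f).cont.comp
      (continuous_pi fun j => continuous_const.clm_comp (hρ j (k j)))

namespace MultiplierDiagonal

variable {ι : Type*} [Fintype ι] (D : MultiplierDiagonal A ι)

/-- The right multipliers on the segment from the trivial diagonal to the given one. -/
def right (z : ℂ) (k : ι) : A →L[ℂ] A := D.base k + z • D.dir k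

theorem right_zero : D.right 0 = D.base := by ext; simp [right]

theorem continuous_right (k : ι) : Continuous fun z => D.right z k := by
  unfold right; fun_prop

theorem base_mul (k : ι) (a b : A) : D.base k (a * b) = a * D.base k b := by
  by_cases h : k = D.unit
  · rw [h, D.base_unit]; rfl
  · rw [D.base_of_ne k h]; simp

theorem sum_base (a b : A) : ∑ k, D.base k a * D.left k b = a * b := by
  rw [Finset.sum_eq_single D.unit (fun k _ hk => by simp [D.base_of_ne k hk]) (by simp),
    D.base_unit, D.left_unit]
  rfl

theorem junctionSum_base {n : ℕ} (f : Cochain A n) :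
    junctionSum D.left (fun _ => D.base) f = f := by
  ext a
  rw [junctionSum_apply, Finset.sum_eq_single (fun _ => D.unit) (fun k _ hk => ?_) (by simp)]
  · simp only [D.left_unit, D.base_unit]
    rfl
  · obtain ⟨j, hj⟩ := Function.ne_iff.1 hk
    exact f.map_coord_zero j (by simp [D.base_of_ne _ hj])

/-- The averaging operator of the diagonal at parameter `z`. -/
def average {n : ℕ} (z : ℂ) (f : Cochain A n) : Cochain A n :=
  junctionSum D.left (fun _ => D.right z) f

/-- The term of the derivative of `D.average z f` at the junction `j`. -/
def averageDeriv {n : ℕ} (j : Fin (n + 1)) (z : ℂ) (f : Cochain A n) : Cochain A n :=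
  junctionSum D.left (Function.update (fun _ => D.right z) j D.dir) f

/-- Leibniz rule: the average is multilinear in the families placed at the junctions, each of them
affine in z. -/
theorem hasDerivAt_average {n : ℕ} (z : ℂ) (f : Cochain A n) :
    HasDerivAt (fun z => D.average z f) (∑ j, D.averageDeriv j z f) z := by
  unfold average averageDeriv junctionSum
  rw [Finset.sum_comm]
  refine HasDerivAt.fun_sum fun k _ => ?_
  have h1 (j : Fin (n + 1)) : HasFDerivAt
      (fun z => (D.left (k ((finRotate (n + 1)).symm j))).comp (D.right z (k j)))
      (ContinuousLinearMap.toSpanSingleton ℂ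
        ((D.left (k ((finRotate (n + 1)).symm j))).comp (D.dir (k j)))) z := by
    have h2 : HasDerivAt (fun z => D.right z (k j)) (D.dir (k j)) z := by
      unfold right
      simpa using ((hasDerivAt_id z).smul_const (D.dir (k j))).const_add (D.base (k j))
    exact ((ContinuousLinearMap.compL ℂ A A A
      (D.left (k ((finRotate (n + 1)).symm j)))).hasFDerivAt.comp_hasDerivAt z h2).hasFDerivAt
  have h3 := (HasFDerivAt.multilinear_comp (ContinuousMultilinearMap.compContinuousLinearMapLRight
    (𝕜 := ℂ) (E := fun _ : Fin (n + 1) => A) f) h1).hasDerivAt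
  convert! h3 using 1
  rw [_root_.sum_apply]
  refine Finset.sum_congr rfl fun j _ => ?_
  change f.compContinuousLinearMap _ = f.compContinuousLinearMap _
  congr 1
  ext i x
  rcases eq_or_ne i j with rfl | h
  · simp
  · simp [h]

theorem average_shift {n : ℕ} (z : ℂ) (f : Cochain A n) :
    D.average z (shift A n f) = shift A n (D.average z f) := junctionSum_shift _ _

theorem average_mem {n : ℕ} (z : ℂ) {f : Cochain A n} (hf : f ∈ cyclicCochains A n) :
    D.average z f ∈ cyclicCochains A n := by
  rw [mem_cyclicCochains_iff, ← average_shift, mem_cyclicCochains_iff.1 hf]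

theorem average_cyclicNorm {n : ℕ} (z : ℂ) (f : Cochain A n) :
    D.average z (cyclicNorm A n f) = cyclicNorm A n (D.average z f) := by
  let P : Module.End ℂ (Cochain A n) :=
    { toFun := D.average z
      map_add' := junctionSum_add _ _
      map_smul' := junctionSum_smul _ _ }
  have hP : Commute P (shift A n) := by
    ext f : 1
    exact D.average_shift z f
  have h2 : Commute P (cyclicNorm A n) := Commute.sum_right _ _ _ fun i _ => hP.pow_right i
  exact congrArg (fun T : Module.End ℂ (Cochain A n) => T f) h2.eq

theorem shift_averageDeriv {n : ℕ} (j : Fin (n + 1)) (z : ℂ) {f : Cochain A n}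
    (hf : f ∈ cyclicCochains A n) :
    shift A n (D.averageDeriv j z f) = D.averageDeriv (finRotate (n + 1) j) z f := by
  conv_rhs => rw [← mem_cyclicCochains_iff.1 hf]
  change _ = junctionSum _ _ ((-1 : ℂ) ^ n • f.domDomCongr (finRotate (n + 1)))
  rw [junctionSum_smul, junctionSum_domDomCongr _ _ _ _ (fun j => by simp)]
  have : (fun i => Function.update (fun _ => D.right z) (finRotate (n + 1) j) D.dir
      (finRotate (n + 1) i)) = Function.update (fun _ => D.right z) j D.dir := by
    ext i : 1
    simp only [Function.update_apply, EmbeddingLike.apply_eq_iff_eq]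
  rw [this]
  rfl

/-- The shift moves the differentiated junction one place on, so its orbit runs once through all
junctions. -/
theorem cyclicNorm_averageDeriv {n : ℕ} (z : ℂ) {f : Cochain A n}
    (hf : f ∈ cyclicCochains A n) :
    cyclicNorm A n (D.averageDeriv (Fin.last n) z f) = ∑ j, D.averageDeriv j z f := by
  -- The rotation sends the last junction to 0, so junction i is reached after i + 1 shifts.
  have h (i : ℕ) (hi : i < n + 1) :
      (shift A n ^ (i + 1)) (D.averageDeriv (Fin.last n) z f) = D.averageDeriv ⟨i, hi⟩ z f := by
    induction i with
    | zero => rw [zero_add, pow_one, D.shift_averageDeriv _ _ hf, finRotate_last]; rfl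
    | succ i ih =>
      rw [pow_succ', Module.End.mul_apply, ih (by omega), D.shift_averageDeriv _ _ hf,
        finRotate_of_lt (by omega)]
  rw [← cyclicNorm_mul_shift, Module.End.mul_apply, cyclicNorm_apply, Finset.sum_range]
  refine Finset.sum_congr rfl fun i _ => ?_
  rw [← h i i.is_lt, pow_succ, Module.End.mul_apply]

theorem integral_cyclicNorm_averageDeriv {n : ℕ} {f : Cochain A n}
    (hf : f ∈ cyclicCochains A n) :
    ∫ s in (0 : ℝ)..1, cyclicNorm A n (D.averageDeriv (Fin.last n) s f) = D.average 1 f - f := by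
  have hc : Continuous fun s : ℝ => ∑ j, D.averageDeriv j s f := by
    refine continuous_finsetSum _ fun j _ => continuous_junctionSum _ (fun i k => ?_) _
    rcases eq_or_ne i j with rfl | h
    · simp only [Function.update_self]; exact continuous_const
    · simp only [Function.update_of_ne h]
      exact (D.continuous_right k).comp Complex.continuous_ofReal
  simp only [D.cyclicNorm_averageDeriv _ hf]
  rw [intervalIntegral.integral_eq_sub_of_hasDerivAt (f := fun s : ℝ => D.average s f)
    (fun s _ => by
      simpa [Function.comp_def] using (D.hasDerivAt_average (s : ℂ) f).scomp s Complex.ofRealCLM.hasDerivAt) (hc.intervalIntegrable _ _)]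
  simp only [Complex.ofReal_one, Complex.ofReal_zero]
  congr 1
  unfold average
  rw [right_zero]
  exact D.junctionSum_base f

section Ring

theorem right_mul [SMulCommClass ℂ A A] (z : ℂ) (k : ι) (a b : A) : D.right z k (a * b) = a * D.right z k b := by
  simp [right, D.base_mul, D.dir_mul, mul_add, mul_smul_comm]

theorem sum_right [IsScalarTower ℂ A A] (z : ℂ) (a b : A) : ∑ k, D.right z k a * D.left k b = a * b := by
  simp [right, add_mul, Finset.sum_add_distrib, D.sum_base, smul_mul_assoc, ← Finset.smul_sum,
    D.sum_dir]

variable [IsScalarTower ℂ A A] [SMulCommClass ℂ A A]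

theorem average_face_zero {n : ℕ} (z : ℂ) (f : Cochain A n) :
    D.average z (face 0 f) = face 0 (D.average z f) := by
  unfold average
  rw [junctionSum_face D.left_mul (fun _ => D.right z) 0 1 (D.right_mul z) (fun a b => by
    rw [D.sum_right, one_smul]), one_smul]

/-- On cyclic cochains δ is N applied to face 0, and averaging commutes with both because the
diagonal multiplies to 1 for every z. -/
theorem coboundary_average {n : ℕ} (z : ℂ) {f : Cochain A n} (hf : f ∈ cyclicCochains A n) :
    coboundary A n (D.average z f) = D.average z (coboundary A n f) := by
  rw [coboundary_of_mem hf, coboundary_of_mem (D.average_mem z hf), average_cyclicNorm,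
    average_face_zero]

end Ring

end MultiplierDiagonal

end Path

end BanachCyclic

end

noncomputable section

namespace BanachCyclic

/-! ### Inserting an argument at the last junction -/

section Homotopy

variable {A : Type u} [NonUnitalNormedRing A]

theorem contractNth_snoc {n : ℕ} (i : Fin (n + 1)) (a : Fin (n + 2) → A) (e : A) :
    (i.castSucc.castSucc.contractNth (· * ·) (Fin.snoc a e : Fin (n + 3) → A) :
        Fin (n + 2) → A) =
      Fin.snoc (i.castSucc.contractNth (· * ·) a : Fin (n + 1) → A) e := by
  ext q
  cases q using Fin.lastCases with
  | last =>
    rw [Fin.contractNth_apply_of_gt _ _ _ _ (by simp; omega), Fin.succ_last, Fin.snoc_last, Fin.snoc_last]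
  | cast q =>
    rw [Fin.snoc_castSucc]
    rcases lt_trichotomy (q : ℕ) (i : ℕ) with h | h | h
    · rw [Fin.contractNth_apply_of_lt _ _ _ _ (by simpa using h),
        Fin.contractNth_apply_of_lt _ _ _ _ (by simpa using h), Fin.snoc_castSucc]
    · rw [Fin.contractNth_apply_of_eq _ _ _ _ (by simpa using h),
        Fin.contractNth_apply_of_eq _ _ _ _ (by simpa using h), Fin.snoc_castSucc,
        Fin.succ_castSucc, Fin.snoc_castSucc]
    · rw [Fin.contractNth_apply_of_gt _ _ _ _ (by simpa using h),
        Fin.contractNth_apply_of_gt _ _ _ _ (by simpa using h), Fin.succ_castSucc,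
        Fin.snoc_castSucc]

theorem contractNth_zero_snoc_comp_finRotate_symm {n : ℕ} (a : Fin (n + 1) → A) (e : A) :
    ((0 : Fin (n + 1)).castSucc.contractNth (· * ·)
      ((Fin.snoc a e : Fin (n + 2) → A) ∘ (finRotate (n + 2)).symm) : Fin (n + 1) → A) =
        Function.update a 0 (e * a 0) := by
  ext q
  cases q using Fin.cases with
  | zero =>
    rw [Fin.contractNth_apply_of_eq _ _ _ _ (by simp), Function.comp_apply, Function.comp_apply,
      Fin.castSucc_zero, finRotate_symm_zero, finRotate_symm_succ, Fin.snoc_last,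
      Fin.snoc_castSucc, Function.update_self]
  | succ q =>
    rw [Fin.contractNth_apply_of_gt _ _ _ _ (by simp), Function.comp_apply,
      finRotate_symm_succ, Fin.snoc_castSucc, Function.update_of_ne (Fin.succ_ne_zero q)]

variable [NormedSpace ℂ A]

namespace MultiplierDiagonal

variable {ι : Type*} [Fintype ι] (D : MultiplierDiagonal A ι)

/-- Right multipliers for the junctions of a tuple into whose last junction a new argument has
been inserted. -/
def insertRight (n : ℕ) (z : ℂ) : Fin (n + 2) → ι → A →L[ℂ] A :=
  Fin.snoc (α := fun _ => ι → A →L[ℂ] A)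
    (Function.update (fun _ : Fin (n + 1) => D.right z) (Fin.last n) D.dir) D.base

theorem insertRight_last (n : ℕ) (z : ℂ) : D.insertRight n z (Fin.last (n + 1)) = D.base := by
  simp [insertRight]

theorem insertRight_castSucc (n : ℕ) (z : ℂ) (j : Fin (n + 1)) :
    D.insertRight n z j.castSucc = Function.update (fun _ => D.right z) (Fin.last n) D.dir j := by
  simp only [insertRight, Fin.snoc_castSucc]

theorem insertRight_castSucc_castSucc (n : ℕ) (z : ℂ) (j : Fin n) :
    D.insertRight n z j.castSucc.castSucc = D.right z := by
  rw [insertRight_castSucc, Function.update_of_ne (Fin.castSucc_lt_last j).ne]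

theorem insertRight_castSucc_last (n : ℕ) (z : ℂ) :
    D.insertRight n z (Fin.last n).castSucc = D.dir := by
  rw [insertRight_castSucc, Function.update_self]

theorem insertRight_succAbove (n : ℕ) (z : ℂ) (i : Fin (n + 1)) (j : Fin (n + 2)) :
    D.insertRight (n + 1) z (i.castSucc.castSucc.succAbove j) = D.insertRight n z j := by
  cases j using Fin.lastCases with
  | last =>
    rw [Fin.succAbove_of_le_castSucc _ _ (Fin.castSucc_le_castSucc_iff.2 (Fin.le_last _)),
      Fin.succ_last, insertRight_last, insertRight_last]
  | cast j =>
    rw [Fin.castSucc_succAbove_castSucc]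
    cases j using Fin.lastCases with
    | last =>
      rw [Fin.succAbove_of_le_castSucc _ _ (Fin.castSucc_le_castSucc_iff.2 (Fin.le_last _)),
        Fin.succ_last, insertRight_castSucc_last, insertRight_castSucc_last]
    | cast j =>
      rw [Fin.castSucc_succAbove_castSucc, insertRight_castSucc_castSucc,
        insertRight_castSucc_castSucc]

/-- Insertion of the argument `e` behind the last one, split by the diagonal. -/
def insertion {n : ℕ} (z : ℂ) (e : A) (f : Cochain A (n + 1)) : Cochain A n :=
  (ContinuousLinearMap.apply ℂ ℂ e).compContinuousMultilinearMap
    (junctionSum D.left (D.insertRight n z) f).curryRight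

theorem insertion_apply {n : ℕ} (z : ℂ) (e : A) (f : Cochain A (n + 1)) (a : Fin (n + 1) → A) :
    D.insertion z e f a = junctionSum D.left (D.insertRight n z) f (Fin.snoc a e) := rfl

theorem norm_insertion_le {n : ℕ} (z : ℂ) (e : A) (f : Cochain A (n + 1)) :
    ‖D.insertion z e f‖ ≤ ‖junctionSum D.left (D.insertRight n z) f‖ * ‖e‖ := by
  refine ContinuousMultilinearMap.opNorm_le_bound (by positivity) fun a => ?_
  rw [insertion_apply]
  refine (ContinuousMultilinearMap.le_opNorm _ _).trans_eq ?_
  rw [Fin.prod_univ_castSucc]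
  simp only [Fin.snoc_castSucc, Fin.snoc_last]
  ring

theorem continuous_insertion {n : ℕ} (e : A) (f : Cochain A (n + 1)) :
    Continuous fun z => D.insertion z e f := by
  have h : Continuous fun z => junctionSum D.left (D.insertRight n z) f := by
    refine continuous_junctionSum _ (fun j k => ?_) _
    cases j using Fin.lastCases with
    | last => simp only [insertRight_last]; exact continuous_const
    | cast j =>
      cases j using Fin.lastCases with
      | last => simp only [insertRight_castSucc_last]; exact continuous_const
      | cast j => simp only [insertRight_castSucc_castSucc]; exact D.continuous_right k
  exact ((ContinuousLinearMap.compContinuousMultilinearMapL ℂ (fun _ : Fin (n + 1) => A) (A →L[ℂ] ℂ) ℂ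
    (ContinuousLinearMap.apply ℂ ℂ e)).continuous.comp
      (continuousMultilinearCurryRightEquiv ℂ (fun _ : Fin (n + 2) => A) ℂ).continuous).comp h

theorem insertion_add {n : ℕ} (z : ℂ) (e : A) (f g : Cochain A (n + 1)) :
    D.insertion z e (f + g) = D.insertion z e f + D.insertion z e g := by
  ext a
  simp only [insertion_apply, junctionSum_add, _root_.add_apply]

theorem insertion_smul {n : ℕ} (z : ℂ) (e : A) (c : ℂ) (f : Cochain A (n + 1)) :
    D.insertion z e (c • f) = c • D.insertion z e f := by
  ext a
  simp only [insertion_apply, junctionSum_smul, _root_.smul_apply]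

/-- `D.insertion z e` as a linear map. -/
def insertionLinear (n : ℕ) (z : ℂ) (e : A) : Cochain A (n + 1) →ₗ[ℂ] Cochain A n where
  toFun := D.insertion z e
  map_add' := D.insertion_add z e
  map_smul' := D.insertion_smul z e

theorem insertRight_mul [SMulCommClass ℂ A A] (n : ℕ) (z : ℂ) (j : Fin (n + 2)) (k : ι) (a b : A) :
    D.insertRight n z j k (a * b) = a * D.insertRight n z j k b := by
  cases j using Fin.lastCases with
  | last => rw [insertRight_last, D.base_mul]
  | cast j =>
    cases j using Fin.lastCases with
    | last => rw [insertRight_castSucc_last, D.dir_mul]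
    | cast j => rw [insertRight_castSucc_castSucc, D.right_mul]

variable [IsScalarTower ℂ A A] [SMulCommClass ℂ A A]

theorem insertion_face_castSucc {n : ℕ} (z : ℂ) (e : A) (i : Fin (n + 1)) (f : Cochain A (n + 1)) :
    D.insertion z e (face i.castSucc f) = face i (D.insertion z e f) := by
  ext a
  rw [insertion_apply, junctionSum_face D.left_mul _ _ 1 (D.insertRight_mul _ _ _) (fun a b => by
    rw [insertRight_castSucc_castSucc, D.sum_right, one_smul]), one_smul]
  simp only [insertRight_succAbove]
  change junctionSum _ _ f _ = junctionSum _ _ f _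
  congr 1
  exact contractNth_snoc i a e

/-- This face multiplies the last argument by e across the junction carrying the direction, whose
legs multiply to 0. -/
theorem insertion_face_last {n : ℕ} (z : ℂ) (e : A) (f : Cochain A n) :
    D.insertion z e (face (Fin.last n) f) = 0 := by
  ext a
  rw [insertion_apply, junctionSum_face D.left_mul _ _ 0 (D.insertRight_mul _ _ _) (fun a b => by
    rw [insertRight_castSucc_last, D.sum_dir, zero_smul]), zero_smul]
  rfl

/-- The cyclic face multiplies e into the first argument across the trivial diagonal, which
disappears; the direction is left at the last junction. -/
theorem insertion_lastFace {n : ℕ} (z : ℂ) (e : A) (f : Cochain A n) (a : Fin (n + 1) → A) :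
    D.insertion z e (lastFace f) a =
      D.averageDeriv (Fin.last n) z f (Function.update a 0 (e * a 0)) := by
  rw [insertion_apply, lastFace, junctionSum_domDomCongr _ _ _ _ (fun j => rfl),
    junctionSum_face D.left_mul
    (fun j => D.insertRight n z ((finRotate (n + 1 + 1)).symm j)) 0 1 (D.insertRight_mul _ _ _) (fun a b => by
    rw [Fin.castSucc_zero, finRotate_symm_zero, insertRight_last, D.sum_base, one_smul]), one_smul]
  have h : (fun j => D.insertRight n z
      ((finRotate (n + 1 + 1)).symm ((Fin.castSucc 0).succAbove j))) =
      Function.update (fun _ => D.right z) (Fin.last n) D.dir := by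
    ext j : 1
    rw [Fin.castSucc_zero, Fin.zero_succAbove, finRotate_symm_succ, insertRight_castSucc]
  rw [h]
  exact congrArg _ (contractNth_zero_snoc_comp_finRotate_symm a e)

/-- Of the n + 3 faces of f, the first n + 1 commute with the insertion, the next one vanishes, and
the cyclic one, of sign (-1)^(n+2), leaves the derivative term. -/
theorem insertion_coboundary {n : ℕ} (z : ℂ) (e : A) (f : Cochain A (n + 1))
    (a : Fin (n + 2) → A) :
    D.insertion z e (coboundary A (n + 1) f) a =
      (∑ i ∈ Finset.range (n + 1), signedFace A n i (D.insertion z e f)) a +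
        (-1) ^ n * D.averageDeriv (Fin.last (n + 1)) z f (Function.update a 0 (e * a 0)) := by
  have h1 : D.insertion z e (signedFace A (n + 1) (n + 1) f) = 0 := by
    rw [signedFace_of_lt (by omega), insertion_smul]
    exact smul_eq_zero_of_right _ (D.insertion_face_last z e f)
  have h2 : ∀ i ∈ Finset.range (n + 1), D.insertion z e (signedFace A (n + 1) i f) =
      signedFace A n i (D.insertion z e f) := by
    intro i hi
    have hi' := Finset.mem_range.1 hi
    rw [signedFace_of_lt (by omega), signedFace_of_lt hi', insertion_smul]
    exact congrArg _ (D.insertion_face_castSucc z e ⟨i, hi'⟩ f)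
  have h3 : D.insertion z e (coboundary A (n + 1) f) =
      ∑ i ∈ Finset.range (n + 3), D.insertion z e (signedFace A (n + 1) i f) := by
    rw [coboundary_eq_sum]
    exact map_sum (D.insertionLinear (n + 1) z e) _ _
  rw [h3, Finset.sum_range_succ, Finset.sum_range_succ, h1, add_zero, Finset.sum_congr rfl h2,
    _root_.add_apply, signedFace_last, insertion_smul, _root_.smul_apply, insertion_lastFace,
    smul_eq_mul]
  ring

end MultiplierDiagonal

end Homotopy

end BanachCyclic

end

noncomputable section

namespace BanachCyclic

open Filter Topology

/-! ### Pointwise limits of bounded families of cochains -/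

section Limit

variable {A : Type u} [NonUnitalNormedRing A] [NormedSpace ℂ A]

/-- Bounded families of cochains have pointwise limits along ultrafilters. -/
theorem exists_tendsto_cochain {α : Type*} (U : Ultrafilter α) {n : ℕ} {g : α → Cochain A n}
    {C : ℝ} (hg : ∀ᶠ x in (U : Filter α), ‖g x‖ ≤ C) :
    ∃ G : Cochain A n, ‖G‖ ≤ C ∧ ∀ a, Tendsto (fun x => g x a) U (𝓝 (G a)) := by
  have hb (a : Fin (n + 1) → A) : ∀ᶠ x in (U : Filter α), ‖g x a‖ ≤ C * ∏ i, ‖a i‖ :=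
    hg.mono fun x hx => ((g x).le_opNorm a).trans (by gcongr)
  have hlim (a : Fin (n + 1) → A) : ∃ z : ℂ, Tendsto (fun x => g x a) U (𝓝 z) := by
    obtain ⟨z, -, hz⟩ := (isCompact_closedBall (0 : ℂ) (C * ∏ i, ‖a i‖)).ultrafilter_le_nhds'
      (U.map fun x => g x a) ((hb a).mono fun x hx => by simpa using hx)
    exact ⟨z, hz⟩
  choose G hG using hlim
  have hC : 0 ≤ C := by
    obtain ⟨x, hx⟩ := hg.exists
    exact (norm_nonneg _).trans hx
  let Gm : MultilinearMap ℂ (fun _ : Fin (n + 1) => A) ℂ :=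
    { toFun := G
      map_update_add' := fun a i x y => by
        refine tendsto_nhds_unique (hG _) ?_
        simp only [ContinuousMultilinearMap.map_update_add]
        exact (hG _).add (hG _)
      map_update_smul' := fun a i c x => by
        refine tendsto_nhds_unique (hG _) ?_
        simp only [ContinuousMultilinearMap.map_update_smul]
        exact (hG _).const_smul c }
  have hGb (a : Fin (n + 1) → A) : ‖Gm a‖ ≤ C * ∏ i, ‖a i‖ :=
    le_of_tendsto (hG a).norm (hb a)
  exact ⟨Gm.mkContinuous C hGb, Gm.mkContinuous_norm_le hC hGb, hG⟩

/-- Evaluation of the bar differential at a point. -/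
def barEval {n : ℕ} (a : Fin (n + 2) → A) : Cochain A n →L[ℂ] ℂ :=
  ∑ i : Fin (n + 1), (-1 : ℂ) ^ (i : ℕ) •
    ContinuousMultilinearMap.apply ℂ (fun _ : Fin (n + 1) => A) ℂ (i.castSucc.contractNth (· * ·) a)

theorem tendsto_barEval {α : Type*} {l : Filter α} {n : ℕ} {g : α → Cochain A n} {G : Cochain A n}
    (h : ∀ a, Tendsto (fun x => g x a) l (𝓝 (G a))) (a : Fin (n + 2) → A) :
    Tendsto (fun x => barEval a (g x)) l (𝓝 (barEval a G)) := by
  simp only [barEval, _root_.sum_apply]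
  exact tendsto_finsetSum _ fun i _ =>
    (h (i.castSucc.contractNth (· * ·) a)).const_smul ((-1 : ℂ) ^ (i : ℕ))

variable [IsScalarTower ℂ A A] [SMulCommClass ℂ A A]

theorem barEval_apply {n : ℕ} (a : Fin (n + 2) → A) (f : Cochain A n) :
    barEval a f = (∑ i ∈ Finset.range (n + 1), signedFace A n i f) a := by
  rw [Finset.sum_range, _root_.sum_apply, barEval, _root_.sum_apply]
  refine Finset.sum_congr rfl fun i _ => ?_
  rw [signedFace_of_lt i.is_lt]
  rfl

theorem tendsto_coboundary {α : Type*} {l : Filter α} {n : ℕ} {g : α → Cochain A n}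
    {G : Cochain A n} (h : ∀ a, Tendsto (fun x => g x a) l (𝓝 (G a))) (a : Fin (n + 2) → A) :
    Tendsto (fun x => coboundary A n (g x) a) l (𝓝 (coboundary A n G a)) := by
  have h1 (f : Cochain A n) : coboundary A n f a = barEval a f + (-1) ^ (n + 1) * lastFace f a := by
    rw [coboundary_eq_sum, Finset.sum_range_succ, _root_.add_apply, barEval_apply,
      signedFace_last]
    rfl
  simp only [h1]
  exact (tendsto_barEval h a).add ((h _).const_mul _)

omit [IsScalarTower ℂ A A] [SMulCommClass ℂ A A] in
theorem mem_cyclicCochains_of_tendsto {α : Type*} {l : Filter α} [l.NeBot] {n : ℕ}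
    {g : α → Cochain A n} {G : Cochain A n} (h : ∀ a, Tendsto (fun x => g x a) l (𝓝 (G a)))
    (hg : ∀ x, g x ∈ cyclicCochains A n) : G ∈ cyclicCochains A n := by
  rw [mem_cyclicCochains_iff]
  ext a
  refine tendsto_nhds_unique ?_ (h a)
  have h1 (x : α) : g x a = (-1) ^ n * g x (a ∘ finRotate (n + 1)) := by
    rw [← shift_apply, mem_cyclicCochains_iff.1 (hg x)]
  simp only [h1]
  exact (h _).const_mul _

end Limit

/-! ### Norm bounds and the cochain bounding average minus identity -/

namespace MultiplierDiagonal

variable {A : Type u} [NonUnitalNormedRing A] [NormedSpace ℂ A] {ι : Type*} [Fintype ι]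
  (D : MultiplierDiagonal A ι)

/-- A bound for the difference of the diagonal with the trivial one. -/
def bound : ℝ := ∑ k, ‖D.left k‖ * ‖D.dir k‖

theorem bound_nonneg : 0 ≤ D.bound := Finset.sum_nonneg fun _ _ => by positivity

theorem sum_norm_base_le : ∑ k, ‖D.left k‖ * ‖D.base k‖ ≤ 1 := by
  rw [Finset.sum_eq_single D.unit (fun k _ hk => by simp [D.base_of_ne k hk]) (by simp),
    D.base_unit, D.left_unit]
  have h := ContinuousLinearMap.norm_id_le (𝕜 := ℂ) (E := A)
  nlinarith [norm_nonneg (ContinuousLinearMap.id ℂ A)]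

theorem sum_norm_right_le {z : ℂ} (hz : ‖z‖ ≤ 1) :
    ∑ k, ‖D.left k‖ * ‖D.right z k‖ ≤ 1 + D.bound := by
  calc ∑ k, ‖D.left k‖ * ‖D.right z k‖
      ≤ ∑ k, (‖D.left k‖ * ‖D.base k‖ + ‖D.left k‖ * ‖D.dir k‖) := by
        refine Finset.sum_le_sum fun k _ => ?_
        rw [← mul_add]
        refine mul_le_mul_of_nonneg_left ((norm_add_le _ _).trans ?_) (norm_nonneg _)
        rw [norm_smul]
        nlinarith [norm_nonneg (D.dir k)]
    _ ≤ 1 + D.bound := by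
        rw [Finset.sum_add_distrib]
        exact add_le_add_left D.sum_norm_base_le _

theorem norm_junctionSum_le_pow {n : ℕ} {ρ : Fin (n + 1) → ι → A →L[ℂ] A} {C : ℝ}
    (hρ : ∀ j, ∑ k, ‖D.left k‖ * ‖ρ j k‖ ≤ C) (f : Cochain A n) :
    ‖junctionSum D.left ρ f‖ ≤ C ^ (n + 1) * ‖f‖ := by
  refine (norm_junctionSum_le _ _ _).trans ?_
  rw [mul_comm]
  gcongr
  refine (Finset.prod_le_prod (fun j _ => Finset.sum_nonneg fun _ _ => by positivity)
    fun j _ => hρ j).trans_eq ?_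
  simp

theorem norm_average_le {n : ℕ} (f : Cochain A n) :
    ‖D.average 1 f‖ ≤ (1 + D.bound) ^ (n + 1) * ‖f‖ :=
  D.norm_junctionSum_le_pow (fun _ => D.sum_norm_right_le (by simp)) f

theorem norm_insertion_le_pow {n : ℕ} {z : ℂ} (hz : ‖z‖ ≤ 1) (e : A) (f : Cochain A (n + 1)) :
    ‖D.insertion z e f‖ ≤ (1 + D.bound) ^ (n + 2) * ‖f‖ * ‖e‖ := by
  refine (D.norm_insertion_le z e f).trans ?_
  gcongr
  refine D.norm_junctionSum_le_pow (fun j => ?_) f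
  cases j using Fin.lastCases with
  | last =>
    rw [insertRight_last]
    linarith [D.sum_norm_base_le, D.bound_nonneg]
  | cast j =>
    cases j using Fin.lastCases with
    | last =>
      rw [insertRight_castSucc_last]
      exact (le_add_of_nonneg_left zero_le_one : D.bound ≤ 1 + D.bound)
    | cast j =>
      rw [insertRight_castSucc_castSucc]
      exact D.sum_norm_right_le hz

variable [IsScalarTower ℂ A A] [SMulCommClass ℂ A A]

/-- The integral over z of the insertions, in the limit over e, has bar differential ± Q, and N Q is
the integral of the derivative of the average. Applying N therefore solves the equation for h, and
keeps h cyclic; the factor n + 1 is the norm bound of N. -/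
theorem exists_coboundary_eq_average_sub {l : Filter A}
    (hl : l.IsApproximateUnit) {K : ℝ} (hK : ∀ᶠ e in l, ‖e‖ ≤ K) {n : ℕ} {f : Cochain A (n + 1)}
    (hf : f ∈ cyclicCochains A (n + 1)) (hδ : coboundary A (n + 1) f = 0) :
    ∃ h ∈ cyclicCochains A n, ‖h‖ ≤ (n + 1) * ((1 + D.bound) ^ (n + 2) * ‖f‖ * K) ∧
      coboundary A n h = D.average 1 f - f := by
  have := hl.neBot
  let U : Ultrafilter A := Ultrafilter.of l
  have hU : (U : Filter A) ≤ l := Ultrafilter.of_le l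
  let H (e : A) : Cochain A n := ∫ s in (0 : ℝ)..1, D.insertion s e f
  let Q : Cochain A (n + 1) := ∫ s in (0 : ℝ)..1, D.averageDeriv (Fin.last (n + 1)) s f
  have hcQ : Continuous fun s : ℝ => D.averageDeriv (Fin.last (n + 1)) s f := by
    refine continuous_junctionSum _ (fun i k => ?_) _
    rcases eq_or_ne i (Fin.last (n + 1)) with rfl | h
    · simp only [Function.update_self]; exact continuous_const
    · simp only [Function.update_of_ne h]
      exact (D.continuous_right k).comp Complex.continuous_ofReal
  have hcH (e : A) : Continuous fun s : ℝ => D.insertion s e f :=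
    (D.continuous_insertion e f).comp Complex.continuous_ofReal
  have hHb (e : A) : ‖H e‖ ≤ (1 + D.bound) ^ (n + 2) * ‖f‖ * ‖e‖ := by
    refine (intervalIntegral.norm_integral_le_of_norm_le_const fun s hs => ?_).trans_eq
      (by rw [sub_zero, abs_one, mul_one])
    rw [Set.uIoc_of_le zero_le_one] at hs
    refine D.norm_insertion_le_pow ?_ e f
    rw [Complex.norm_real, Real.norm_of_nonneg hs.1.le]
    exact hs.2
  have hHQ (e : A) (a : Fin (n + 2) → A) :
      barEval a (H e) = -((-1) ^ n * Q (Function.update a 0 (e * a 0))) := by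
    have h1 : barEval a (H e) = ∫ s in (0 : ℝ)..1, barEval a (D.insertion s e f) :=
      ((barEval a).intervalIntegral_comp_comm ((hcH e).intervalIntegrable _ _)).symm
    have h2 (a : Fin (n + 2) → A) :
        Q a = ∫ s in (0 : ℝ)..1, D.averageDeriv (Fin.last (n + 1)) s f a :=
      ((ContinuousMultilinearMap.apply ℂ (fun _ : Fin (n + 2) => A) ℂ a).intervalIntegral_comp_comm
        (hcQ.intervalIntegrable _ _)).symm
    rw [h1, h2, ← intervalIntegral.integral_const_mul, ← intervalIntegral.integral_neg]
    refine intervalIntegral.integral_congr fun s _ => ?_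
    have h3 := D.insertion_coboundary s e f a
    rw [hδ, ← barEval_apply] at h3
    have h4 : D.insertion s e (0 : Cochain A (n + 2)) a = 0 := by
      rw [show D.insertion s e (0 : Cochain A (n + 2)) = 0 from
        map_zero (D.insertionLinear (n + 1) s e)]
      rfl
    rw [h4] at h3
    exact (neg_eq_of_add_eq_zero_left h3.symm).symm
  obtain ⟨G, hGb, hG⟩ := exists_tendsto_cochain U (g := H)
    (C := (1 + D.bound) ^ (n + 2) * ‖f‖ * K) (by
      filter_upwards [hU hK] with e he
      have := D.bound_nonneg
      exact (hHb e).trans (by gcongr))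
  have hGQ : ∑ i ∈ Finset.range (n + 1), signedFace A n i G = (-1 : ℂ) ^ (n + 1) • Q := by
    ext a
    rw [← barEval_apply]
    refine tendsto_nhds_unique (tendsto_barEval hG a) ?_
    simp only [hHQ]
    -- The approximate identity removes the factor e left by the cyclic face, Q being jointly
    -- continuous.
    have h1 : Tendsto (fun e => Function.update a 0 (e * a 0)) (U : Filter A) (𝓝 a) := by
      conv => rhs; rw [← Function.update_eq_self 0 a]
      exact tendsto_const_nhds.update 0 ((hl.tendsto_mul_right (a 0)).mono_left hU)
    have h2 := (((Q.cont.tendsto a).comp h1).const_mul ((-1 : ℂ) ^ n)).neg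
    convert! h2 using 2
    rw [_root_.smul_apply, smul_eq_mul, pow_succ]
    ring_nf
    rfl
  refine ⟨(-1 : ℂ) ^ (n + 1) • cyclicNorm A n G, Submodule.smul_mem _ _ (cyclicNorm_mem G), ?_, ?_⟩
  · rw [norm_smul, norm_pow, norm_neg, norm_one, one_pow, one_mul]
    exact (norm_cyclicNorm_le G).trans (by gcongr)
  · rw [map_smul, ← cyclicNorm_sum_signedFace, hGQ, map_smul, smul_smul, ← mul_pow, neg_mul_neg,
      one_mul, one_pow, one_smul, ← D.integral_cyclicNorm_averageDeriv hf]
    exact (((cyclicNorm A (n + 1)).mkContinuous _ norm_cyclicNorm_le).intervalIntegral_comp_comm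
      (hcQ.intervalIntegrable _ _)).symm

end MultiplierDiagonal

end BanachCyclic

end

noncomputable section

namespace BanachCyclic

/-! ### One junction viewed as a bilinear form in its two operators -/

section JunctionForm

variable {A : Type u} [NonUnitalNormedRing A] [NormedSpace ℂ A]

/-- Tuples obtained from `a` by acting with operators on both sides of each junction. -/
def junctionTuple {n : ℕ} (lam rho : Fin (n + 1) → A →L[ℂ] A) (a : Fin (n + 1) → A) :
    Fin (n + 1) → A :=
  fun i => lam ((finRotate (n + 1)).symm i) (rho i (a i))

theorem junctionTuple_update_right {n : ℕ} (lam rho : Fin (n + 1) → A →L[ℂ] A)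
    (a : Fin (n + 1) → A) (j : Fin (n + 1)) (r : A →L[ℂ] A) :
    junctionTuple lam (Function.update rho j r) a =
      Function.update (junctionTuple lam rho a) j
        (lam ((finRotate (n + 1)).symm j) (r (a j))) := by
  ext i
  rcases eq_or_ne i j with rfl | h
  · simp only [junctionTuple, Function.update_self]
  · simp only [junctionTuple, Function.update_of_ne h]

theorem junctionTuple_update_left {n : ℕ} (lam rho : Fin (n + 1) → A →L[ℂ] A)
    (a : Fin (n + 1) → A) (j : Fin (n + 1)) (l : A →L[ℂ] A) :
    junctionTuple (Function.update lam j l) rho a =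
      Function.update (junctionTuple lam rho a) (finRotate (n + 1) j)
        (l (rho (finRotate (n + 1) j) (a (finRotate (n + 1) j)))) := by
  ext i
  rcases eq_or_ne i (finRotate (n + 1) j) with rfl | h
  · simp only [junctionTuple, Function.update_self, Equiv.symm_apply_apply]
  · have h' : (finRotate (n + 1)).symm i ≠ j := fun e => h (by rw [← e, Equiv.apply_symm_apply])
    simp only [junctionTuple, Function.update_of_ne h, Function.update_of_ne h']

theorem norm_apply_junctionTuple_le {n : ℕ} (f : Cochain A n) (lam rho : Fin (n + 1) → A →L[ℂ] A)
    (a : Fin (n + 1) → A) :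
    ‖f (junctionTuple lam rho a)‖ ≤ ‖f‖ * (∏ i, ‖lam i‖ * ‖rho i‖) * ∏ i, ‖a i‖ := by
  refine (f.le_opNorm _).trans ?_
  rw [mul_assoc]
  refine mul_le_mul_of_nonneg_left ?_ (norm_nonneg f)
  rw [Finset.prod_mul_distrib, ← Equiv.prod_comp (finRotate (n + 1)).symm (fun j => ‖lam j‖),
    ← Finset.prod_mul_distrib, ← Finset.prod_mul_distrib]
  refine Finset.prod_le_prod (fun _ _ => norm_nonneg _) fun i _ => ?_
  refine (ContinuousLinearMap.le_opNorm _ _).trans ?_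
  rw [mul_assoc]
  exact mul_le_mul_of_nonneg_left (ContinuousLinearMap.le_opNorm _ _) (norm_nonneg _)

theorem norm_apply_junctionTuple_update_le {n : ℕ} (f : Cochain A n)
    (lam rho : Fin (n + 1) → A →L[ℂ] A) (a : Fin (n + 1) → A) (j : Fin (n + 1))
    (r l : A →L[ℂ] A) :
    ‖f (junctionTuple (Function.update lam j l) (Function.update rho j r) a)‖ ≤
      (‖f‖ * (∏ i, ‖lam (j.succAbove i)‖ * ‖rho (j.succAbove i)‖) * ∏ i, ‖a i‖) *
        ‖r‖ * ‖l‖ := by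
  refine (norm_apply_junctionTuple_le _ _ _ _).trans_eq ?_
  rw [Fin.prod_univ_succAbove _ j]
  simp only [Function.update_self, Function.update_of_ne (Fin.succAbove_ne j _)]
  ring

/-- The value of a cochain as a bilinear form in the operators at the junction `j`. -/
def junctionForm {n : ℕ} (lam rho : Fin (n + 1) → A →L[ℂ] A) (f : Cochain A n)
    (a : Fin (n + 1) → A) (j : Fin (n + 1)) : (A →L[ℂ] A) →L[ℂ] (A →L[ℂ] A) →L[ℂ] ℂ :=
  LinearMap.mkContinuous₂ (LinearMap.mk₂ ℂ
    (fun r l => f (junctionTuple (Function.update lam j l) (Function.update rho j r) a))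
    (fun r r' l => by simp [junctionTuple_update_right])
    (fun c r l => by simp [junctionTuple_update_right])
    (fun r l l' => by simp [junctionTuple_update_left])
    (fun c r l => by simp [junctionTuple_update_left]))
    (‖f‖ * (∏ i, ‖lam (j.succAbove i)‖ * ‖rho (j.succAbove i)‖) * ∏ i, ‖a i‖)
    (fun r l => norm_apply_junctionTuple_update_le f lam rho a j r l)

theorem junctionForm_apply {n : ℕ} (lam rho : Fin (n + 1) → A →L[ℂ] A) (f : Cochain A n)
    (a : Fin (n + 1) → A) (j : Fin (n + 1)) (r l : A →L[ℂ] A) :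
    junctionForm lam rho f a j r l =
      f (junctionTuple (Function.update lam j l) (Function.update rho j r) a) := rfl

theorem norm_junctionForm_apply_le {n : ℕ} (lam rho : Fin (n + 1) → A →L[ℂ] A) (f : Cochain A n)
    (a : Fin (n + 1) → A) (j : Fin (n + 1)) (r l : A →L[ℂ] A) :
    ‖junctionForm lam rho f a j r l‖ ≤
      (‖f‖ * (∏ i, ‖lam (j.succAbove i)‖ * ‖rho (j.succAbove i)‖) * ∏ i, ‖a i‖) *
        ‖r‖ * ‖l‖ :=
  norm_apply_junctionTuple_update_le f lam rho a j r l

variable {ι : Type*} [Fintype ι]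

/-- Isolates the sum at one junction, freezing the indices at the others. κ₀ is a filler at index j:
the form overwrites that entry. -/
theorem junctionSum_eq_sum_junctionForm (L : ι → A →L[ℂ] A) {n : ℕ}
    (ρ : Fin (n + 1) → ι → A →L[ℂ] A) (f : Cochain A n) (a : Fin (n + 1) → A) (j : Fin (n + 1))
    (κ₀ : ι) :
    junctionSum L ρ f a = ∑ k : Fin n → ι, ∑ κ,
      junctionForm (fun i => L (j.insertNth (α := fun _ => ι) κ₀ k i))
        (fun i => ρ i (j.insertNth (α := fun _ => ι) κ₀ k i)) f a j (ρ j κ) (L κ) := by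
  rw [junctionSum_apply, ← (Fin.insertNthEquiv (fun _ => ι) j).sum_comp,
    Fintype.sum_prod_type_right]
  refine Finset.sum_congr rfl fun k _ => Finset.sum_congr rfl fun κ _ => ?_
  rw [junctionForm_apply]
  congr 1
  have h (M : Fin (n + 1) → ι → A →L[ℂ] A) :
      Function.update (fun i => M i (j.insertNth (α := fun _ => ι) κ₀ k i)) j (M j κ) =
        fun i => M i (j.insertNth (α := fun _ => ι) κ k i) := by
    ext i : 1
    rcases eq_or_ne i j with rfl | hi
    · simp
    · obtain ⟨i, rfl⟩ := Fin.exists_succAbove_eq hi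
      simp
  rw [h ρ, h fun _ => L]
  rfl

variable {n : ℕ} (lam rho : Fin (n + 1) → A →L[ℂ] A) (f : Cochain A n)
  (a : Fin (n + 1) → A) (j : Fin (n + 1)) (r l : A →L[ℂ] A)

theorem junctionForm_update_right (s : A →L[ℂ] A) :
    junctionForm lam rho f (Function.update a j (s (a j))) j r l =
      junctionForm lam rho f a j (r.comp s) l := by
  rw [junctionForm_apply, junctionForm_apply]
  congr 1
  ext i
  rcases eq_or_ne i j with rfl | h
  · simp only [junctionTuple, Function.update_self, ContinuousLinearMap.comp_apply]
  · simp only [junctionTuple, Function.update_of_ne h]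

theorem junctionForm_update_left (s : A →L[ℂ] A) (hr : ∀ x, r (s x) = s (r x))
    (hrho : ∀ i x, rho i (s x) = s (rho i x)) :
    junctionForm lam rho f
        (Function.update a (finRotate (n + 1) j) (s (a (finRotate (n + 1) j)))) j r l =
      junctionForm lam rho f a j r (l.comp s) := by
  rw [junctionForm_apply, junctionForm_apply]
  congr 1
  have h0 (i x) : Function.update rho j r i (s x) = s (Function.update rho j r i x) := by
    rcases eq_or_ne i j with rfl | h
    · simp only [Function.update_self, hr]
    · simp only [Function.update_of_ne h, hrho]
  ext i
  rcases eq_or_ne i (finRotate (n + 1) j) with rfl | h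
  · simp only [junctionTuple, Function.update_self, ContinuousLinearMap.comp_apply, h0,
      Equiv.symm_apply_apply]
  · have h' : (finRotate (n + 1)).symm i ≠ j := fun e => h (by rw [← e, Equiv.apply_symm_apply])
    simp only [junctionTuple, Function.update_of_ne h, Function.update_of_ne h']

/-- Puts the wrap-around condition on the same footing as the others, as the junction from the last
argument to the first. -/
theorem mem_relativeCochains_iff {B : NonUnitalSubalgebra ℂ A} {f : Cochain A n} :
    f ∈ relativeCochains B n ↔ ∀ s ∈ B, ∀ (a : Fin (n + 1) → A) (j : Fin (n + 1)),
      f (Function.update a j (a j * s)) =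
        f (Function.update a (finRotate (n + 1) j) (s * a (finRotate (n + 1) j))) := by
  refine ⟨fun h s hs a j => ?_, fun h s hs a => ⟨?_, fun j => ?_⟩⟩
  · cases j using Fin.lastCases with
    | last => rw [finRotate_last, (h s hs a).1]
    | cast j => rw [finRotate_castSucc, (h s hs a).2 j]
  · rw [h s hs a (Fin.last n), finRotate_last]
  · rw [h s hs a j.castSucc, finRotate_castSucc]

/-- Relativity carries s across the junction from the right leg to the left one; the outer left
multiplier does not obstruct this, since it commutes with right multiplication by s. -/
theorem junctionForm_of_mem_relativeCochains [IsScalarTower ℂ A A] [SMulCommClass ℂ A A]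
    {B : NonUnitalSubalgebra ℂ A} {f : Cochain A n}
    (hf : f ∈ relativeCochains B n) (hlam : ∀ i x y, lam i (x * y) = lam i x * y) {s : A}
    (hs : s ∈ B) :
    junctionForm lam rho f a j r (ContinuousLinearMap.mul ℂ A s) =
      junctionForm lam rho f a j (((ContinuousLinearMap.mul ℂ A).flip s).comp r)
        (ContinuousLinearMap.id ℂ A) := by
  have h := mem_relativeCochains_iff.1 hf s hs (junctionTuple
    (Function.update lam j (ContinuousLinearMap.id ℂ A)) (Function.update rho j r) a) j
  have hlam' (i x y) : Function.update lam j (ContinuousLinearMap.id ℂ A) i (x * y) =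
      Function.update lam j (ContinuousLinearMap.id ℂ A) i x * y := by
    rcases eq_or_ne i j with rfl | h
    · simp only [Function.update_self]; rfl
    · simp only [Function.update_of_ne h, hlam]
  have h1 := junctionTuple_update_left (Function.update lam j (ContinuousLinearMap.id ℂ A))
    (Function.update rho j r) a j (ContinuousLinearMap.mul ℂ A s)
  have h2 := junctionTuple_update_right (Function.update lam j (ContinuousLinearMap.id ℂ A))
    (Function.update rho j r) a j (((ContinuousLinearMap.mul ℂ A).flip s).comp r)
  rw [Function.update_idem] at h1 h2
  rw [junctionForm_apply, junctionForm_apply, h1, h2]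
  convert! h.symm using 2
  · congr 1
    simp only [junctionTuple, Equiv.symm_apply_apply, Function.update_self]
    rfl
  · congr 1
    simp only [junctionTuple, ← hlam', Function.update_self]
    rfl

end JunctionForm

end BanachCyclic

end

noncomputable section

namespace BanachCyclic

open Filter Topology

/-! ### Multiplier diagonals built from pairs in the subalgebra -/

section Pairs

variable {A : Type u} [NonUnitalNormedRing A] [NormedSpace ℂ A] [IsScalarTower ℂ A A]
  [SMulCommClass ℂ A A] (B : NonUnitalSubalgebra ℂ A)

/-- The inclusion of a subalgebra. -/
def subalgebraInclusion : B →L[ℂ] A where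
  toFun := Subtype.val
  map_add' _ _ := rfl
  map_smul' _ _ := rfl
  cont := continuous_subtype_val

/-- Right multiplication by elements of the unitization of `B`. -/
def unitizationRight : (ℂ × B) →L[ℂ] A →L[ℂ] A :=
  (ContinuousLinearMap.fst ℂ ℂ B).smulRight (ContinuousLinearMap.id ℂ A) +
    (ContinuousLinearMap.mul ℂ A).flip.comp
      ((subalgebraInclusion B).comp (ContinuousLinearMap.snd ℂ ℂ B))

/-- Left multiplication by elements of `B`. -/
def subalgebraLeft : B →L[ℂ] A →L[ℂ] A :=
  (ContinuousLinearMap.mul ℂ A).comp (subalgebraInclusion B)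

variable {B}

theorem unitizationRight_apply (x : ℂ × B) (a : A) :
    unitizationRight B x a = x.1 • a + a * (x.2 : A) := rfl

theorem subalgebraLeft_apply (y : B) (a : A) : subalgebraLeft B y a = y * a := rfl

theorem norm_unitizationRight_le (x : ℂ × B) : ‖unitizationRight B x‖ ≤ 2 * ‖x‖ := by
  refine ContinuousLinearMap.opNorm_le_bound _ (by positivity) fun a => ?_
  rw [unitizationRight_apply]
  have h1 : ‖x.1 • a‖ ≤ ‖x‖ * ‖a‖ := by
    rw [norm_smul]; gcongr; exact norm_fst_le x
  have h2 : ‖a * (x.2 : A)‖ ≤ ‖x‖ * ‖a‖ :=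
    (norm_mul_le _ _).trans (by rw [mul_comm]; gcongr; exact norm_snd_le x)
  linarith [norm_add_le (x.1 • a) (a * (x.2 : A))]

theorem norm_subalgebraLeft_le (y : B) : ‖subalgebraLeft B y‖ ≤ ‖y‖ :=
  ContinuousLinearMap.opNorm_le_bound _ (norm_nonneg _) fun _ => norm_mul_le _ _

theorem unitizationRight_comp_zero_mk (x : ℂ × B) (s : B) :
    (unitizationRight B x).comp (unitizationRight B (0, s)) =
      unitizationRight B (0, x.1 • s + s * x.2) := by
  ext a
  simp [unitizationRight_apply, mul_add, mul_assoc, mul_smul_comm]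

theorem unitizationRight_zero_mk_comp (x : ℂ × B) (y : B) :
    (unitizationRight B (0, y)).comp (unitizationRight B x) =
      unitizationRight B (0, x.1 • y + x.2 * y) := by
  ext a
  simp [unitizationRight_apply, mul_add, add_mul, mul_assoc, mul_smul_comm, smul_mul_assoc]

theorem unitizationRight_one : unitizationRight B (1, 0) = ContinuousLinearMap.id ℂ A := by
  ext a
  simp [unitizationRight_apply]

theorem subalgebraLeft_comp (y s : B) :
    (subalgebraLeft B y).comp (subalgebraLeft B s) = subalgebraLeft B (y * s) := by
  ext a
  simp [subalgebraLeft_apply, mul_assoc]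

theorem norm_unitizationRight_zero_mk_le (x : ℂ × B) (y : B) :
    ‖unitizationRight B (0, x.1 • y + x.2 * y)‖ ≤ 4 * ‖x‖ * ‖y‖ := by
  refine (norm_unitizationRight_le _).trans ?_
  rw [norm_zero_prod_mk]
  linarith [norm_smul_add_mul_le x y]

variable {κ : Type*} [Fintype κ]

/-- The diagonal `1 ⊗ 1 + ∑ k, (x k ⊗ y k - x k * y k ⊗ 1)`. -/
def diagonalOfPairs (x : κ → ℂ × B) (y : κ → B) : MultiplierDiagonal A (Option κ) where
  left k := k.elim (ContinuousLinearMap.id ℂ A) fun k => subalgebraLeft B (y k)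
  base k := k.elim (ContinuousLinearMap.id ℂ A) fun _ => 0
  dir k := k.elim (-∑ k, unitizationRight B (0, (x k).1 • y k + (x k).2 * y k))
    fun k => unitizationRight B (x k)
  unit := none
  left_unit := rfl
  base_unit := rfl
  base_of_ne k hk := by
    cases k with
    | none => exact absurd rfl hk
    | some k => rfl
  left_mul k a b := by
    cases k with
    | none => rfl
    | some k => simp [subalgebraLeft_apply, mul_assoc]
  dir_mul k a b := by
    cases k with
    | none =>
      simp [unitizationRight_apply, _root_.sum_apply, mul_add, Finset.mul_sum, mul_assoc]
    | some k => simp [unitizationRight_apply, mul_add, mul_assoc, mul_smul_comm]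
  sum_dir a b := by
    rw [Fintype.sum_option]
    simp only [Option.elim_none, Option.elim_some, neg_apply, _root_.sum_apply,
      ContinuousLinearMap.id_apply, neg_mul, Finset.sum_mul]
    rw [neg_add_eq_zero]
    refine Finset.sum_congr rfl fun k _ => ?_
    simp [unitizationRight_apply, subalgebraLeft_apply, mul_add, add_mul, mul_assoc,
      mul_smul_comm, smul_mul_assoc]

variable (x : κ → ℂ × B) (y : κ → B)

/-- The correction terms x_k y_k ⊗ 1 contribute 4 K and the terms x_k ⊗ y_k contribute 2 K. -/
theorem bound_diagonalOfPairs_le {K : ℝ} (hK : ∑ k, ‖x k‖ * ‖y k‖ ≤ K) :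
    (diagonalOfPairs x y).bound ≤ 6 * K := by
  have h1 : ‖∑ k, unitizationRight B (0, (x k).1 • y k + (x k).2 * y k)‖ ≤ 4 * K := by
    refine (norm_sum_le _ _).trans ((Finset.sum_le_sum fun k _ =>
      (norm_unitizationRight_zero_mk_le (x k) (y k))).trans ?_)
    simp only [mul_assoc]
    rw [← Finset.mul_sum]
    linarith
  have h2 : ∑ k, ‖subalgebraLeft B (y k)‖ * ‖unitizationRight B (x k)‖ ≤ 2 * K := by
    calc _ ≤ ∑ k, 2 * (‖x k‖ * ‖y k‖) := by
          refine Finset.sum_le_sum fun k _ => ?_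
          calc _ ≤ ‖y k‖ * (2 * ‖x k‖) := by
                gcongr
                · exact norm_subalgebraLeft_le _
                · exact norm_unitizationRight_le _
            _ = _ := by ring
      _ ≤ 2 * K := by rw [← Finset.mul_sum]; linarith
  have h3 := ContinuousLinearMap.norm_id_le (𝕜 := ℂ) (E := A)
  unfold MultiplierDiagonal.bound
  rw [Fintype.sum_option]
  simp only [diagonalOfPairs, Option.elim_none, Option.elim_some, norm_neg]
  nlinarith [norm_nonneg (∑ k, unitizationRight B (0, (x k).1 • y k + (x k).2 * y k))]

theorem right_one_none : (diagonalOfPairs x y).right 1 none =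
    ContinuousLinearMap.id ℂ A -
      ∑ k, unitizationRight B (0, (x k).1 • y k + (x k).2 * y k) := by
  simp [MultiplierDiagonal.right, diagonalOfPairs, sub_eq_add_neg]

theorem right_one_some (k : κ) :
    (diagonalOfPairs x y).right 1 (some k) = unitizationRight B (x k) := by
  simp [MultiplierDiagonal.right, diagonalOfPairs]

theorem left_none : (diagonalOfPairs x y).left none = ContinuousLinearMap.id ℂ A := rfl

theorem left_some (k : κ) : (diagonalOfPairs x y).left (some k) = subalgebraLeft B (y k) := rfl

/-- The form `T(x, y) - T(x y, 1)` on the unitization of `B` given by a bilinear form `T` on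
operators. -/
def restrictForm (T : (A →L[ℂ] A) →L[ℂ] (A →L[ℂ] A) →L[ℂ] ℂ) : UnitizationForm B :=
  ((ContinuousLinearMap.compL ℂ B (A →L[ℂ] A) ℂ).flip (subalgebraLeft B)).comp
      (T.comp (unitizationRight B)) -
    (ContinuousLinearMap.compL ℂ B B ℂ (((T.flip (ContinuousLinearMap.id ℂ A)).comp
      (unitizationRight B)).comp (ContinuousLinearMap.inr ℂ ℂ B))).comp (unitizationMul B)

theorem restrictForm_apply (T : (A →L[ℂ] A) →L[ℂ] (A →L[ℂ] A) →L[ℂ] ℂ) (x : ℂ × B) (y : B) :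
    restrictForm T x y = T (unitizationRight B x) (subalgebraLeft B y) -
      T (unitizationRight B (0, x.1 • y + x.2 * y)) (ContinuousLinearMap.id ℂ A) := rfl

theorem norm_restrictForm_le {T : (A →L[ℂ] A) →L[ℂ] (A →L[ℂ] A) →L[ℂ] ℂ} {C : ℝ} (hC : 0 ≤ C)
    (hT : ∀ r l, ‖T r l‖ ≤ C * ‖r‖ * ‖l‖) : ‖(restrictForm T : UnitizationForm B)‖ ≤ 6 * C := by
  refine ContinuousLinearMap.opNorm_le_bound₂ _ (by positivity) fun x y => ?_
  rw [restrictForm_apply]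
  have h1 : ‖T (unitizationRight B x) (subalgebraLeft B y)‖ ≤ C * (2 * ‖x‖) * ‖y‖ := by
    refine (hT _ _).trans ?_
    gcongr
    · exact norm_unitizationRight_le x
    · exact norm_subalgebraLeft_le y
  have h2 : ‖T (unitizationRight B (0, x.1 • y + x.2 * y)) (ContinuousLinearMap.id ℂ A)‖ ≤
      C * (4 * ‖x‖ * ‖y‖) * 1 := by
    refine (hT _ _).trans ?_
    gcongr
    · exact norm_unitizationRight_zero_mk_le x y
    · exact ContinuousLinearMap.norm_id_le
  refine (norm_sub_le _ _).trans ?_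
  linarith

/-- Translates the commutator of s with the diagonal, tested on operators, into the defect that
approximate diagonals make small, tested on the restricted form. -/
theorem sum_commutator_diagonalOfPairs (T : (A →L[ℂ] A) →L[ℂ] (A →L[ℂ] A) →L[ℂ] ℂ) (s : B) :
    ∑ k, (T (((diagonalOfPairs x y).right 1 k).comp (unitizationRight B (0, s)))
        ((diagonalOfPairs x y).left k) -
      T ((diagonalOfPairs x y).right 1 k)
        (((diagonalOfPairs x y).left k).comp (subalgebraLeft B s))) =
    -((restrictForm T : UnitizationForm B) (1, 0) s -
      ∑ k, ((restrictForm T).rightAct s (x k) (y k) - (restrictForm T).leftAct s (x k) (y k))) := by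
  rw [Fintype.sum_option, right_one_none, left_none]
  simp only [right_one_some, left_some, subalgebraLeft_comp, unitizationRight_comp_zero_mk,
    ContinuousLinearMap.sub_comp, ContinuousLinearMap.id_comp, restrictForm_apply,
    UnitizationForm.rightAct_apply, UnitizationForm.leftAct_apply, unitizationRight_one,
    ContinuousLinearMap.finsetSum_comp, map_sub, map_sum, sub_apply, _root_.sum_apply,
    zero_smul, zero_add, one_smul, zero_mul, add_zero]
  have h1 (k : κ) : (x k).1 • (y k * s) + (x k).2 * (y k * s) =
      ((x k).1 • y k + (x k).2 * y k) * s := by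
    rw [add_mul, smul_mul_assoc, mul_assoc]
  have h2 (k : κ) : ((x k).1 • s + s * (x k).2) * y k = s * ((x k).1 • y k + (x k).2 * y k) := by
    rw [add_mul, mul_add, smul_mul_assoc, mul_smul_comm, mul_assoc]
  simp only [h1, h2, Finset.sum_sub_distrib]
  ring

/-- Moving s across junction j changes the average only by the commutator of s with the diagonal
placed there, because s passes the multipliers belonging to the neighbouring junctions. -/
theorem norm_average_commutator_le {n : ℕ} (f : Cochain A n) (a : Fin (n + 1) → A)
    (j : Fin (n + 1)) (s : B) {ε : ℝ} (hε : 0 ≤ ε)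
    (h : ∀ ψ : UnitizationForm B,
      ‖ψ (1, 0) s - ∑ k, (ψ.rightAct s (x k) (y k) - ψ.leftAct s (x k) (y k))‖ ≤ ε * ‖ψ‖) :
    ‖(diagonalOfPairs x y).average 1 f (Function.update a j (a j * s)) -
        (diagonalOfPairs x y).average 1 f (Function.update a (finRotate (n + 1) j)
          (s * a (finRotate (n + 1) j)))‖ ≤
      ε * (6 * (‖f‖ * (1 + (diagonalOfPairs x y).bound) ^ n * ∏ i, ‖a i‖)) := by
  set D := diagonalOfPairs x y with hD
  unfold MultiplierDiagonal.average
  have hs1 : a j * (s : A) = unitizationRight B (0, s) (a j) := by simp [unitizationRight_apply]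
  have hs2 : (s : A) * a (finRotate (n + 1) j) = subalgebraLeft B s (a (finRotate (n + 1) j)) := rfl
  have hright (k : Option κ) (b : A) :
      D.right 1 k (subalgebraLeft B s b) = subalgebraLeft B s (D.right 1 k b) :=
    D.right_mul 1 k s b
  rw [junctionSum_eq_sum_junctionForm _ _ _ _ j none,
    junctionSum_eq_sum_junctionForm _ _ _ _ j none, hs1, hs2, ← Finset.sum_sub_distrib]
  simp only [junctionForm_update_right, junctionForm_update_left, hright, implies_true,
    ← Finset.sum_sub_distrib]
  simp only [hD, sum_commutator_diagonalOfPairs]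
  simp only [← hD]
  refine (norm_sum_le _ _).trans ?_
  calc _ ≤ ∑ k : Fin n → Option κ,
        ε * (6 * (‖f‖ * (∏ i, ‖D.left (k i)‖ * ‖D.right 1 (k i)‖) * ∏ i, ‖a i‖)) := by
        refine Finset.sum_le_sum fun k _ => ?_
        rw [norm_neg]
        refine (h _).trans ?_
        gcongr
        refine norm_restrictForm_le (by positivity) fun r l => ?_
        refine (norm_junctionForm_apply_le _ _ _ _ _ _ _).trans_eq ?_
        simp only [Fin.insertNth_apply_succAbove]
    -- The n junctions other than j are independent, so the sum over their indices is an n-th power.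
    _ = ε * (6 * (‖f‖ * (∑ k, ‖D.left k‖ * ‖D.right 1 k‖) ^ n * ∏ i, ‖a i‖)) := by
        rw [← Finset.mul_sum, ← Finset.mul_sum, ← Finset.sum_mul, ← Finset.mul_sum,
          Fintype.sum_pow]
    _ ≤ _ := by
        gcongr
        exact D.sum_norm_right_le (by simp)

/-- On a relative cochain x_k ⊗ y_k acts like x_k y_k ⊗ 1, so the direction acts as 0 at each
junction. The average is then constant in z and equals its value at z = 0, which is f. -/
theorem average_of_mem_relativeCochains {n : ℕ} {f : Cochain A n} (hf : f ∈ relativeCochains B n) :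
    (diagonalOfPairs x y).average 1 f = f := by
  set D := diagonalOfPairs x y with hD
  have h0 (w : ℂ) (j : Fin (n + 1)) : D.averageDeriv j w f = 0 := by
    ext a
    unfold MultiplierDiagonal.averageDeriv
    rw [junctionSum_eq_sum_junctionForm _ _ _ _ j none, zero_apply]
    refine Finset.sum_eq_zero fun k _ => ?_
    rw [Function.update_self, Fintype.sum_option]
    have h1 (lam rho : Fin (n + 1) → A →L[ℂ] A) (hlam : ∀ i b c, lam i (b * c) = lam i b * c)
        (k : κ) : junctionForm lam rho f a j (D.dir (some k)) (D.left (some k)) =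
          junctionForm lam rho f a j (unitizationRight B (0, (x k).1 • y k + (x k).2 * y k))
            (ContinuousLinearMap.id ℂ A) := by
      rw [← unitizationRight_zero_mk_comp]
      refine (junctionForm_of_mem_relativeCochains _ _ _ _ _ hf hlam (y k).2).trans ?_
      congr 2
      ext b
      simp [unitizationRight_apply, hD, diagonalOfPairs, add_mul, smul_mul_assoc]
    rw [Finset.sum_congr rfl fun k _ => h1 _ _ (fun i => D.left_mul _) k]
    have h2 : D.dir none = -∑ k, unitizationRight B (0, (x k).1 • y k + (x k).2 * y k) := rfl
    rw [h2, map_neg, map_sum, neg_apply, _root_.sum_apply]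
    exact neg_add_cancel _
  have hd (w : ℂ) : HasDerivAt (fun w => D.average w f) 0 w := by
    simpa [h0] using D.hasDerivAt_average w f
  have h1 := is_const_of_deriv_eq_zero (fun w => (hd w).differentiableAt) (fun w => (hd w).deriv) 1 0
  rw [show D.average 1 f = D.average 0 f from h1]
  unfold MultiplierDiagonal.average
  rw [D.right_zero, D.junctionSum_base]

end Pairs

end BanachCyclic

end

noncomputable section

namespace BanachCyclic

open Filter Topology

/-! ### Averaging in the limit and the comparison map -/

section Comparison

variable {A : Type u} [NonUnitalNormedRing A] [NormedSpace ℂ A] [IsScalarTower ℂ A A]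
  [SMulCommClass ℂ A A] {B : NonUnitalSubalgebra ℂ A}

/-- A net of averaging operators on cochains, whose pointwise limits are `B`-relative. -/
theorem exists_averaging (hA : HasBoundedApproximateIdentity A) (hB : IsAmenableBanachAlgebra B) :
    ∃ (α : Type u) (U : Ultrafilter α) (P : α → ∀ n, Cochain A n → Cochain A n),
      (∀ n, ∃ C : ℝ, ∀ f : Cochain A n, ∃ G ∈ relativeCochains B n, ‖G‖ ≤ C * ‖f‖ ∧
        ∀ a, Tendsto (fun i => P i n f a) U (𝓝 (G a))) ∧
      (∀ i n, ∀ f ∈ cyclicCochains A n, P i n f ∈ cyclicCochains A n ∧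
        coboundary A n (P i n f) = P i (n + 1) (coboundary A n f)) ∧
      (∀ i n, ∀ f ∈ relativeCochains B n, P i n f = f) ∧
      ∀ n, ∃ C : ℝ, ∀ f ∈ cyclicCochains A (n + 1), coboundary A (n + 1) f = 0 → ∀ i,
        ∃ h ∈ cyclicCochains A n, ‖h‖ ≤ C * ‖f‖ ∧ coboundary A n h = P i (n + 1) f - f := by
  classical
  obtain ⟨l, hl, M, hM⟩ := hA
  obtain ⟨K, hK, hdiag⟩ := exists_approximate_diagonal hB
  have hM' : ∀ᶠ e in l, ‖e‖ ≤ |M| := hM.mono fun e he => he.trans (le_abs_self M)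
  -- The index (F, m) demands commutation with F up to 1/(m + 1), under a norm bound K independent
  -- of the index.
  choose κ inst x y hxy hcomm using fun i : Finset B × ℕ =>
    hdiag i.1 (1 / ((i.2 : ℝ) + 1)) (by positivity)
  let D (i : Finset B × ℕ) : MultiplierDiagonal A (Option (κ i)) := diagonalOfPairs (x i) (y i)
  have hD (i) : (D i).bound ≤ 6 * K := bound_diagonalOfPairs_le _ _ (hxy i)
  let U : Ultrafilter (Finset B × ℕ) := Ultrafilter.of atTop
  have hU : (U : Filter (Finset B × ℕ)) ≤ atTop := Ultrafilter.of_le _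
  refine ⟨Finset B × ℕ, U, fun i n f => (D i).average 1 f, fun n => ⟨(1 + 6 * K) ^ (n + 1),
    fun f => ?_⟩, fun i n f hf => ⟨(D i).average_mem 1 hf, (D i).coboundary_average 1 hf⟩,
    fun i n f hf => average_of_mem_relativeCochains _ _ hf,
    fun n => ⟨(n + 1) * (1 + 6 * K) ^ (n + 2) * |M|, fun f hf hδ i => ?_⟩⟩
  · obtain ⟨G, hG, hlim⟩ := exists_tendsto_cochain U (g := fun i => (D i).average 1 f)
      (C := (1 + 6 * K) ^ (n + 1) * ‖f‖) (Eventually.of_forall fun i => by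
        have := (D i).bound_nonneg
        refine ((D i).norm_average_le f).trans ?_
        gcongr
        exact hD i)
    refine ⟨G, mem_relativeCochains_iff.2 fun s hs a j => ?_, hG, hlim⟩
    refine sub_eq_zero.1 (tendsto_nhds_unique ((hlim _).sub (hlim _)) ?_)
    set R : ℝ := 6 * (‖f‖ * (1 + 6 * K) ^ n * ∏ i, ‖a i‖) with hR
    have h1 : Tendsto (fun i : Finset B × ℕ => 1 / ((i.2 : ℝ) + 1) * R) U (𝓝 0) := by
      have h2 : Tendsto (fun i : Finset B × ℕ => i.2) U atTop := by
        refine Tendsto.mono_left ?_ hU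
        rw [← prod_atTop_atTop_eq]
        exact tendsto_snd
      simpa using (tendsto_one_div_add_atTop_nhds_zero_nat.comp h2).mul_const R
    refine squeeze_zero_norm' ?_ h1
    filter_upwards [hU (eventually_ge_atTop (({⟨s, hs⟩}, 0) : Finset B × ℕ))] with i hi
    have hi' : (⟨s, hs⟩ : B) ∈ i.1 := Finset.singleton_subset_iff.1 hi.1
    refine (norm_average_commutator_le (x i) (y i) f a j ⟨s, hs⟩ (by positivity)
      (hcomm i ⟨s, hs⟩ hi')).trans ?_
    have := (D i).bound_nonneg
    have h3 : 1 + (diagonalOfPairs (x i) (y i)).bound ≤ 1 + 6 * K := add_le_add_right (hD i) 1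
    rw [hR]
    gcongr
  · obtain ⟨h, hh, hb, he⟩ := (D i).exists_coboundary_eq_average_sub hl hM' hf hδ
    refine ⟨h, hh, hb.trans ?_, he⟩
    have := (D i).bound_nonneg
    calc (n + 1) * ((1 + (D i).bound) ^ (n + 2) * ‖f‖ * |M|)
        ≤ (n + 1) * ((1 + 6 * K) ^ (n + 2) * ‖f‖ * |M|) := by gcongr; exact hD i
      _ = _ := by ring

/-- The relative cocycle is a pointwise limit of averages, and the bounding cochains, bounded
uniformly in the index, have a limit too. The norm bound is what later makes the inverse continuous.
-/
theorem exists_relative_cocycle (hA : HasBoundedApproximateIdentity A)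
    (hB : IsAmenableBanachAlgebra B) (n : ℕ) :
    ∃ C : ℝ, ∀ f ∈ cocycles (cyclicCochains A) n, ∃ z ∈ cocycles (relativeCyclicCochains B) n,
      ‖z‖ ≤ C * ‖f‖ ∧ f - z ∈ coboundaries (cyclicCochains A) n := by
  cases n with
  | zero =>
    refine ⟨1, fun f hf => ⟨f, ⟨⟨hf.1, mem_relativeCochains_iff.2 fun s _ a j => ?_⟩, hf.2⟩,
      (one_mul _).ge, by simp⟩⟩
    obtain rfl : j = 0 := Subsingleton.elim (α := Fin 1) _ _
    -- In degree 0 there is nothing to average: the cocycle identity at (a₀, s) is the trace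
    -- property f(a₀ s) = f(s a₀), which is relativity.
    have h0 : coboundary A 0 f ![a 0, s] = 0 := by
      rw [LinearMap.mem_ker.1 hf.2]; rfl
    have h1 : coboundary A 0 f ![a 0, s] = f (fun _ => a 0 * s) - f (fun _ => s * a 0) := by
      rw [coboundary_eq_sum, Finset.sum_range_succ, Finset.sum_range_one, signedFace_last,
        signedFace_of_lt zero_lt_one]
      change (-1 : ℂ) ^ 0 * f _ + (-1) ^ 1 * f _ = _
      rw [pow_zero, one_mul, pow_one, neg_one_mul, ← sub_eq_add_neg]
      congr 2
      · ext i
        obtain rfl : i = 0 := Subsingleton.elim (α := Fin 1) _ _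
        rfl
      · ext i
        obtain rfl : i = 0 := Subsingleton.elim (α := Fin 1) _ _
        rfl
    rw [h0] at h1
    have hup (c : A) : Function.update a 0 c = fun _ => c := by
      ext i
      obtain rfl : i = 0 := Subsingleton.elim (α := Fin 1) _ _
      simp
    have h2 : finRotate (0 + 1) (0 : Fin (0 + 1)) = 0 := Subsingleton.elim (α := Fin 1) _ _
    rw [h2, hup, hup]
    exact sub_eq_zero.1 h1.symm
  | succ n =>
    obtain ⟨α, U, P, hP1, hP2, hP3, hP4⟩ := exists_averaging hA hB
    obtain ⟨C, hC⟩ := hP1 (n + 1)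
    obtain ⟨C', hC'⟩ := hP4 n
    refine ⟨C, fun f hf => ?_⟩
    have hδ : coboundary A (n + 1) f = 0 := LinearMap.mem_ker.1 hf.2
    obtain ⟨G, hGrel, hGb, hG⟩ := hC f
    choose h hcyc hb hh using hC' f hf.1 hδ
    obtain ⟨H, -, hH⟩ := exists_tendsto_cochain U (Eventually.of_forall hb)
    have hHcyc : H ∈ cyclicCochains A n := mem_cyclicCochains_of_tendsto hH hcyc
    have hHδ : coboundary A n H = G - f := by
      ext a
      refine tendsto_nhds_unique (tendsto_coboundary hH a) ?_
      simp only [hh]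
      exact (hG a).sub tendsto_const_nhds
    refine ⟨G, ⟨⟨mem_cyclicCochains_of_tendsto hG fun i => (hP2 i _ f hf.1).1, hGrel⟩, ?_⟩, hGb,
      -H, neg_mem hHcyc, by rw [map_neg, hHδ, neg_sub]⟩
    change coboundary A (n + 1) G = 0
    ext a
    refine tendsto_nhds_unique (tendsto_coboundary hG a) ?_
    have h0 (i : α) : coboundary A (n + 1) (P i (n + 1) f) = 0 := by
      rw [(hP2 i _ f hf.1).2, hδ, hP3 i _ 0 (zero_mem _)]
    simp only [h0]
    exact tendsto_const_nhds

/-- If z = δg is relative, averaging fixes it, so the averages of g all have coboundary z, and so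
does their relative limit. -/
theorem mem_relative_coboundaries (hA : HasBoundedApproximateIdentity A)
    (hB : IsAmenableBanachAlgebra B) {n : ℕ} {z : Cochain A n}
    (hz : z ∈ relativeCyclicCochains B n) (h : z ∈ coboundaries (cyclicCochains A) n) :
    z ∈ coboundaries (relativeCyclicCochains B) n := by
  cases n with
  | zero => exact h
  | succ n =>
    obtain ⟨α, U, P, hP1, hP2, hP3, -⟩ := exists_averaging hA hB
    obtain ⟨C, hC⟩ := hP1 n
    obtain ⟨g, hg, rfl⟩ := h
    obtain ⟨G, hGrel, -, hG⟩ := hC g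
    refine ⟨G, ⟨mem_cyclicCochains_of_tendsto hG fun i => (hP2 i _ g hg).1, hGrel⟩, ?_⟩
    ext a
    refine tendsto_nhds_unique (tendsto_coboundary hG a) ?_
    have h0 (i : α) : coboundary A n (P i n g) = coboundary A n g := by
      rw [(hP2 i _ g hg).2, hP3 i _ _ hz.2]
    simp only [h0]
    exact tendsto_const_nhds

theorem relativeCoboundaries_le (B : NonUnitalSubalgebra ℂ A) (n : ℕ) :
    coboundaries (relativeCyclicCochains B) n ≤ coboundaries (cyclicCochains A) n := by
  cases n with
  | zero => exact le_rfl
  | succ n => exact Submodule.map_mono inf_le_left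

variable (B) in
/-- The map `HC^n_B(A) → HC^n(A)` induced by the inclusion of cochains. -/
def relativeComparison (n : ℕ) : HCrel B n →ₗ[ℂ] HC A n :=
  Submodule.mapQ _ _ (Submodule.inclusion (relativeCocycles_le B n))
    fun _ hz => relativeCoboundaries_le B n hz

theorem relativeComparison_mk (n : ℕ) (z : cocycles (relativeCyclicCochains B) n) :
    relativeComparison B n (Submodule.Quotient.mk z) =
      Submodule.Quotient.mk (Submodule.inclusion (relativeCocycles_le B n) z) := rfl

theorem relativeComparison_bijective (hA : HasBoundedApproximateIdentity A)
    (hB : IsAmenableBanachAlgebra B) (n : ℕ) : Function.Bijective (relativeComparison B n) := by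
  constructor
  · rw [injective_iff_map_eq_zero]
    intro c hc
    obtain ⟨z, rfl⟩ := Submodule.Quotient.mk_surjective _ c
    rw [relativeComparison_mk, Submodule.Quotient.mk_eq_zero] at hc
    rw [Submodule.Quotient.mk_eq_zero]
    exact mem_relative_coboundaries hA hB z.2.1 hc
  · intro c
    obtain ⟨f, rfl⟩ := Submodule.Quotient.mk_surjective _ c
    obtain ⟨C, hC⟩ := exists_relative_cocycle hA hB n
    obtain ⟨z, hz, -, hzf⟩ := hC f f.2
    refine ⟨Submodule.Quotient.mk ⟨z, hz⟩, ?_⟩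
    rw [relativeComparison_mk, eq_comm, Submodule.Quotient.eq]
    exact hzf

theorem continuous_relativeComparison (n : ℕ) : Continuous (relativeComparison B n) := by
  refine continuous_quot_lift _ ?_
  exact continuous_quot_mk.comp (continuous_induced_rng.2 continuous_subtype_val)

theorem continuous_relativeComparison_symm (hA : HasBoundedApproximateIdentity A)
    (hB : IsAmenableBanachAlgebra B) (n : ℕ) :
    Continuous (LinearEquiv.ofBijective (relativeComparison B n)
      (relativeComparison_bijective hA hB n)).symm := by
  set e := LinearEquiv.ofBijective (relativeComparison B n) (relativeComparison_bijective hA hB n)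
  obtain ⟨C, hC⟩ := exists_relative_cocycle hA hB n
  let T : cocycles (cyclicCochains A) n →ₗ[ℂ] HCrel B n :=
    e.symm.toLinearMap.comp ((coboundaries (cyclicCochains A) n).submoduleOf _).mkQ
  have hT : Continuous T := by
    -- Continuity is checked before passing to the quotient: the class of f is sent to that of a
    -- relative cocycle of norm at most C ‖f‖.
    refine AddMonoidHomClass.continuous_of_bound T C fun f => ?_
    obtain ⟨z, hz, hzb, hzf⟩ := hC f f.2
    have h1 : T f = Submodule.Quotient.mk ⟨z, hz⟩ := by
      change e.symm _ = _
      rw [LinearEquiv.symm_apply_eq]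
      change Submodule.Quotient.mk f = Submodule.Quotient.mk _
      rw [Submodule.Quotient.eq]
      exact hzf
    rw [h1]
    exact (Submodule.Quotient.norm_mk_le _ _).trans hzb
  exact continuous_coinduced_dom.2 hT

end Comparison

end BanachCyclic

end
theorem theorem4p1 (A : Type u) [NonUnitalNormedRing A] [NormedSpace ℂ A] [IsScalarTower ℂ A A]
    [SMulCommClass ℂ A A] [CompleteSpace A] (hA : HasBoundedApproximateIdentity A)
    (B : NonUnitalSubalgebra ℂ A) (hBclosed : IsClosed (B : Set A))
    (hB : IsAmenableBanachAlgebra B) (n : ℕ) :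
    ∃ e : BanachCyclic.HCrel B n ≃L[ℂ] BanachCyclic.HC A n,
      ∀ z : BanachCyclic.cocycles (BanachCyclic.relativeCyclicCochains B) n,
        e (Submodule.Quotient.mk z) =
          Submodule.Quotient.mk (Submodule.inclusion (BanachCyclic.relativeCocycles_le B n) z) :=
  ⟨{ LinearEquiv.ofBijective (BanachCyclic.relativeComparison B n)
      (BanachCyclic.relativeComparison_bijective hA hB n) with
      continuous_toFun := BanachCyclic.continuous_relativeComparison n
      continuous_invFun := BanachCyclic.continuous_relativeComparison_symm hA hB n },
    fun _ => rfl⟩
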